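/- Let $G=(V,E)$ be a finite connected graph (loops and multiple edges allowed), let $\Gamma$ be the metric graph obtained from $G$ by turning each edge into a segment of length $1$, and let $g=|E|-|V|+1$ be its genus. A divisor on $\Gamma$ is an element $D=\sum_p D(p)\,(p)$ of the free abelian group on the points of $\Gamma$; it has degree $\sum_p D(p)$, it is effective if $D(p)\ge 0$ for all $p$, it is integral if $D(p)\neq 0$ only for $p\in V$, and $D\le D'$ means that $D'-D$ is effective. Two divisors $D_1,D_2$ are linearly equivalent if there is a continuous function $\varphi:\Gamma\to\mathbb R$ that is piecewise affine with integer slopes on each edge, such that for every point $p$ the coefficient $D_1(p)-D_2(p)$ is the sum of the incoming slopes of $\varphi$ at $p$. Let $|D|$ be the set of effective divisors linearly equivalent to $D$, and $|D|_G$ the set of integral elements of $|D|$. An open edge of $\Gamma$ is a connected component of the complement of the set of points of valency $\neq 2$; an open edge segment is a nonempty open connected subset of an open edge. A break divisor is a divisor $(p_1)+\dots+(p_g)$ for which there are pairwise disjoint open edge segments $e_1,\dots,e_g$ such that $p_i\in\overline{e_i}$ for all $i$ and $\Gamma\setminus\bigcup_{i=1}^g e_i$ is contractible. A semibreak divisor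 is an effective divisor $D'$ with $D'\le B$ for some break divisor $B$. **Proposition.** Let $D$ be an integral divisor of degree $d$ with $0\le d\le g$ and $|D|_G\neq\emptyset$. Then $|D|$ contains an integral semibreak divisor. Moreover, every semibreak divisor in $|D|$ is integral. -/

import Mathlib

/-- A graph with vertex set `V` and edge set `E`; loops and multiple edges are allowed. Every edge
`e` comes with an ordering `(src e, tgt e)` of its two ends; this choice only serves to parametrize
`e` by the unit interval. -/
structure MultiGraph (V E : Type*) where
  src : E → V
  tgt : E → V

namespace MultiGraph

/-- `G` is connected (and has at least one vertex). Connectedness only depends on the underlying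
simple graph. -/
def Connected {V E : Type*} (G : MultiGraph V E) : Prop :=
  (SimpleGraph.fromRel fun u v : V => ∃ e : E, G.src e = u ∧ G.tgt e = v).Connected

/-- The genus `|E| - |V| + 1`, that is, one minus the Euler characteristic. For connected `G` one
has `|V| ≤ |E| + 1`, so that the subtraction does not truncate. -/
def genus {V E : Type*} [Fintype V] [Fintype E] (_G : MultiGraph V E) : ℕ :=
  Fintype.card E + 1 - Fintype.card V

/-- The points of the metric graph obtained from `G` by turning each edge into a segment of
length one: the vertices of `G`, and the points in the interior of an edge `e`, given by their
distance `t ∈ (0, 1)` from the end `src e` along `e`. -/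
inductive Point {V E : Type*} (G : MultiGraph V E) where
  | vertex (v : V) : Point G
  | inner (e : E) (t : Set.Ioo (0 : ℝ) 1) : Point G

/-- The unit speed parametrization of the closed edge `e`. -/
noncomputable def edgePath {V E : Type*} (G : MultiGraph V E) (e : E) (t : Set.Icc (0 : ℝ) 1) :
    G.Point :=
  if h0 : (t : ℝ) = 0 then .vertex (G.src e)
  else if h1 : (t : ℝ) = 1 then .vertex (G.tgt e)
  else .inner e ⟨t, lt_of_le_of_ne t.2.1 (Ne.symm h0), lt_of_le_of_ne t.2.2 h1⟩

/-- The topology of the metric graph: the quotient topology of the disjoint union of `V`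
and of one interval `[0, 1]` for each edge, glued at the ends. That is, a set is open if and only
if its preimage in each closed edge is open. -/
noncomputable instance instTopologicalSpacePoint {V E : Type*} (G : MultiGraph V E) :
    TopologicalSpace G.Point :=
  ⨆ e : E, TopologicalSpace.coinduced (G.edgePath e) inferInstance

/-- The number of edges emanating from a point; a loop at a vertex counts twice. -/
noncomputable def valency {V E : Type*} (G : MultiGraph V E) : G.Point → ℕ
  | .vertex v => Nat.card {e : E // G.src e = v} + Nat.card {e : E // G.tgt e = v}
  | .inner _ _ => 2

/-- The points of valency different from two. -/
def branchPoints {V E : Type*} (G : MultiGraph V E) : Set G.Point :=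
  {p | G.valency p ≠ 2}

/-- The open edges of the metric graph: the components of the complement of the branch points.
Such an edge may pass through vertices of `G` of valency two. -/
def openEdges {V E : Type*} (G : MultiGraph V E) : Set (Set G.Point) :=
  {c | ∃ x ∈ G.branchPointsᶜ, c = connectedComponentIn G.branchPointsᶜ x}

/-- An open edge segment: a (nonempty) open connected subset of an open edge. -/
def IsOpenEdgeSegment {V E : Type*} (G : MultiGraph V E) (s : Set G.Point) : Prop :=
  IsOpen s ∧ IsConnected s ∧ ∃ c ∈ G.openEdges, s ⊆ c

/-- The group of divisors on the metric graph: the free abelian group on its points. A divisor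
`D` is effective if `0 ≤ D`. -/
abbrev Div {V E : Type*} (G : MultiGraph V E) := G.Point →₀ ℤ

/-- The degree of a divisor. -/
def deg {V E : Type*} {G : MultiGraph V E} (D : G.Div) : ℤ := D.sum fun _ n => n

/-- A divisor is integral if it is supported on the vertices of `G`. -/
def IsIntegral {V E : Type*} {G : MultiGraph V E} (D : G.Div) : Prop :=
  ∀ p ∈ D.support, ∃ v : V, p = .vertex v

/-- A function on the metric graph, restricted to the closed edge `e` and read in the unit speed
parametrization (extended to `ℝ` by constants). -/
noncomputable def onEdge {V E : Type*} {G : MultiGraph V E} (φ : G.Point → ℝ) (e : E) : ℝ → ℝ :=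
  Set.IccExtend zero_le_one fun t => φ (G.edgePath e t)

/-- `f` is piecewise affine with integer slopes on `[0, 1]`: there are finitely many break points
`0 = x₀ < x₁ < ⋯ < xₙ = 1` such that `f` is affine with an integer slope on each
`[xᵢ, xᵢ₊₁]`. -/
def IsPiecewiseAffine (f : ℝ → ℝ) : Prop :=
  ∃ (n : ℕ) (x : Fin (n + 1) → ℝ) (m : Fin n → ℤ), StrictMono x ∧ x 0 = 0 ∧ x (Fin.last n) = 1 ∧
    ∀ i : Fin n, ∀ t ∈ Set.Icc (x i.castSucc) (x i.succ),
      f t = f (x i.castSucc) + m i * (t - x i.castSucc)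

/-- Membership in `R(Γ)`: continuous piecewise affine functions with integer slopes. -/
def IsRational {V E : Type*} {G : MultiGraph V E} (φ : G.Point → ℝ) : Prop :=
  Continuous φ ∧ ∀ e : E, IsPiecewiseAffine (onEdge φ e)

/-- The sum of the incoming slopes of `φ` at a point. The slope coming in from the side of
`src e` is the left derivative on the edge `e`, the slope coming in from the side of `tgt e` is
minus the right derivative. -/
noncomputable def incomingSlopes {V E : Type*} [DecidableEq V] [Fintype E] {G : MultiGraph V E}
    (φ : G.Point → ℝ) : G.Point → ℝ
  | .vertex v =>
      (∑ e : E, if G.tgt e = v then derivWithin (onEdge φ e) (Set.Iic 1) 1 else 0) +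
        ∑ e : E, if G.src e = v then -derivWithin (onEdge φ e) (Set.Ici 0) 0 else 0
  | .inner e t =>
      derivWithin (onEdge φ e) (Set.Iic t) t - derivWithin (onEdge φ e) (Set.Ici t) t

/-- `D₁ ∼ D₂`: there is `φ ∈ R(Γ)` with `D₁ - D₂ = div φ`, where `div φ` is the divisor whose
coefficient at `p` is the sum of the incoming slopes of `φ` at `p`. -/
def LinEquiv {V E : Type*} [DecidableEq V] [Fintype E] {G : MultiGraph V E} (D₁ D₂ : G.Div) :
    Prop :=
  ∃ φ : G.Point → ℝ, IsRational φ ∧ ∀ p, (((D₁ - D₂) p : ℤ) : ℝ) = incomingSlopes φ p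

/-- The complete linear system `|D|`: the effective divisors linearly equivalent to `D`. -/
def linearSystem {V E : Type*} [DecidableEq V] [Fintype E] {G : MultiGraph V E} (D : G.Div) :
    Set G.Div :=
  {D' | 0 ≤ D' ∧ LinEquiv D' D}

/-- `|D|_G`: the effective integral divisors linearly equivalent to `D`. -/
def integralLinearSystem {V E : Type*} [DecidableEq V] [Fintype E] {G : MultiGraph V E}
    (D : G.Div) : Set G.Div :=
  {D' | D' ∈ linearSystem D ∧ IsIntegral D'}

/-- Break divisors, where `g` is the genus: `D = (p₁) + ⋯ + (p_g)` with `pᵢ` in the closure of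
`sᵢ`, for pairwise disjoint open edge segments `s₁, …, s_g` with contractible complement. -/
def IsBreak {V E : Type*} [Fintype V] [Fintype E] {G : MultiGraph V E} (D : G.Div) : Prop :=
  ∃ (s : Fin G.genus → Set G.Point) (p : Fin G.genus → G.Point),
    (∀ i, G.IsOpenEdgeSegment (s i)) ∧ (∀ i j, i ≠ j → Disjoint (s i) (s j)) ∧
    (∀ i, p i ∈ closure (s i)) ∧ D = ∑ i, Finsupp.single (p i) 1 ∧
    ContractibleSpace ↥(⋃ i, s i)ᶜ

/-- Semibreak divisors: effective divisors dominated by a break divisor. -/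
def IsSemibreak {V E : Type*} [Fintype V] [Fintype E] {G : MultiGraph V E} (D : G.Div) : Prop :=
  0 ≤ D ∧ ∃ B : G.Div, IsBreak B ∧ D ≤ B

end MultiGraph

/-!
Existence. Only the vertices matter: an integral divisor is semibreak as soon as its chips can be
assigned to distinct incident edges whose deletion leaves the graph connected. Indeed these edges
then lie in the complement of a spanning tree, the open edges of that complement are `g` disjoint
segments, and what remains is the tree, which is contractible (`isSemibreak_sum_single`,
`RootedTree.contractibleSpace_carrier`). So let `D` be effective and supported on the vertices, and
assign its chips to edges one after the other (`Linked.exists_chips`). Suppose that a set `F` of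
fewer than `g` edges is used, that deleting `F` leaves a connected graph `H`, and that one more chip
sits at a vertex `w`. Since `H` is not a tree, it has an edge `c` that is not a bridge. If `w` is an
end of a nonbridge of `H`, the chip takes that edge. Otherwise a bridge `b` of `H` leads from `w` to
the side `K` containing `c`. Either all chips of `F` on the edges of the cut are outside `K`; then
firing the complement of `K` moves them, and the extra chip, across the cut, and only the extra chip
changes its position relative to `H`. Or some `f` in `F` crossing the cut has its chip in `K`; then
`b` replaces `f` in `F`, and the chip of `f` becomes the extra chip. In both cases the extra chip
enters `K`, and everything outside `K` stays attached to `H` behind it, so that the sets `K` shrink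
and the procedure ends (`exists_chips_add`).

Integrality. Let `g` disjoint open segments have a connected complement. Two segments that meet the
interior of the same edge would force the complement to lie between them on that edge, so all
vertices would have valency two and `g` would be one (`eq_of_meets_same_edge`). Hence the interior of
an edge carries at most one chip of a break divisor. The edges with a chip in their interior do not
disconnect the graph: otherwise the segments would cover one side of a cut formed by such edges, and
the vertices of that side on one segment would be a set of vertices of valency two that is left by
exactly one edge, against parity (`linked_of_isPreconnected`, `IsBreak.inner_chips`). Now let
`φ` realize the equivalence of a semibreak divisor with an integral divisor. Then `φ` is affine with
integer slope on every edge without interior chips, so its values at any two vertices differ by an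
integer. On an edge with one chip at distance `t` from its beginning, the slope drops by one at the
chip, and the two values at the ends differ by an integer plus `t`, which is impossible for
`0 < t < 1` (`LinEquiv.isIntegral`).
-/

open Set Filter Topology

namespace MultiGraph

variable {V E : Type*}

/-! ### Connectedness through cuts -/

/-- The part of `G` on the vertices `K` and the edges of `H` joining them is connected, in the form
of the cut condition: every set `X` of vertices that separates two vertices of `K` is crossed by an
edge of `H` with both ends in `K`. -/
def Linked (G : MultiGraph V E) (H : Set E) (K : Set V) : Prop :=
  ∀ X : Set V, (∃ a ∈ K, a ∈ X) → (∃ b ∈ K, b ∉ X) →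
    ∃ e ∈ H, G.src e ∈ K ∧ G.tgt e ∈ K ∧ ¬(G.src e ∈ X ↔ G.tgt e ∈ X)

theorem Connected.linked {G : MultiGraph V E} (hG : G.Connected) :
    G.Linked Set.univ Set.univ := by
  rintro X ⟨a, -, ha⟩ ⟨b, -, hb⟩
  obtain ⟨p⟩ := hG.preconnected a b
  obtain ⟨d, -, h1, h2⟩ := p.exists_boundary_dart X ha hb
  have h3 := d.adj
  rw [SimpleGraph.fromRel_adj] at h3
  obtain ⟨-, ⟨e, he, he'⟩ | ⟨e, he, he'⟩⟩ := h3 <;>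
    exact ⟨e, trivial, trivial, trivial, by grind⟩

theorem Linked.mono {G : MultiGraph V E} {H H' : Set E} {K : Set V} (h : G.Linked H K)
    (hH : ∀ e ∈ H, G.src e ∈ K → G.tgt e ∈ K → e ∈ H') : G.Linked H' K := by
  intro X ha hb
  obtain ⟨e, he, h1, h2, h3⟩ := h X ha hb
  exact ⟨e, hH e he h1 h2, h1, h2, h3⟩

/-- The component of `a` in the graph on the vertices `P` with edges `H`. -/
theorem exists_linked_component (G : MultiGraph V E) (H : Set E) (P : Set V) {a : V}
    (ha : a ∈ P) : ∃ K ⊆ P, a ∈ K ∧ G.Linked H K ∧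
      ∀ e ∈ H, G.src e ∈ P → G.tgt e ∈ P → (G.src e ∈ K ↔ G.tgt e ∈ K) := by
  let C : Set V → Prop := fun Z => Z ⊆ P ∧ a ∈ Z ∧
    ∀ e ∈ H, G.src e ∈ P → G.tgt e ∈ P → (G.src e ∈ Z ↔ G.tgt e ∈ Z)
  have hP : C P := ⟨subset_rfl, ha, fun e _ h1 h2 => ⟨fun _ => h2, fun _ => h1⟩⟩
  let K : Set V := {v | ∀ Z, C Z → v ∈ Z}
  have hKP : K ⊆ P := fun v hv => hv P hP
  have hcl : ∀ e ∈ H, G.src e ∈ P → G.tgt e ∈ P → (G.src e ∈ K ↔ G.tgt e ∈ K) :=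
    fun e he h1 h2 => ⟨fun h Z hZ => (hZ.2.2 e he h1 h2).1 (h Z hZ),
      fun h Z hZ => (hZ.2.2 e he h1 h2).2 (h Z hZ)⟩
  have haK : a ∈ K := fun Z hZ => hZ.2.1
  have key : ∀ X : Set V, a ∈ X → (∃ b ∈ K, b ∉ X) →
      ∃ e ∈ H, G.src e ∈ K ∧ G.tgt e ∈ K ∧ ¬(G.src e ∈ X ↔ G.tgt e ∈ X) := by
    rintro X haX ⟨b, hb, hbX⟩
    by_contra! hno
    have hC : C (K ∩ X) := by
      refine ⟨fun v hv => hKP hv.1, ⟨haK, haX⟩, fun e he h1 h2 => ?_⟩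
      have := hcl e he h1 h2
      have := hno e he
      simp only [Set.mem_inter_iff]
      tauto
    exact hbX (hb _ hC).2
  refine ⟨K, hKP, haK, ?_, hcl⟩
  rintro X ⟨x, hx, hxX⟩ ⟨y, hy, hyX⟩
  by_cases haX : a ∈ X
  · exact key X haX ⟨y, hy, hyX⟩
  · obtain ⟨e, he, h1, h2, h3⟩ := key Xᶜ haX ⟨x, hx, fun h => h hxX⟩
    exact ⟨e, he, h1, h2, fun h => h3 (by simp [h])⟩

/-- Glueing along an edge: if `H` is linked on `K` and on the complement of `K`, and an edge of `H`
joins the two, then `H` is linked. -/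
theorem Linked.univ_of_compl {G : MultiGraph V E} {H : Set E} {K : Set V} (h1 : G.Linked H K)
    (h2 : G.Linked H Kᶜ) {f : E} (hf : f ∈ H) (hfK : ¬(G.src f ∈ K ↔ G.tgt f ∈ K)) :
    G.Linked H Set.univ := by
  rintro X ⟨a, -, ha⟩ ⟨b, -, hb⟩
  by_cases hK : (∃ a ∈ K, a ∈ X) ∧ ∃ b ∈ K, b ∉ X
  · obtain ⟨e, he, -, -, h⟩ := h1 X hK.1 hK.2
    exact ⟨e, he, trivial, trivial, h⟩
  by_cases hK' : (∃ a ∈ Kᶜ, a ∈ X) ∧ ∃ b ∈ Kᶜ, b ∉ X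
  · obtain ⟨e, he, -, -, h⟩ := h2 X hK'.1 hK'.2
    exact ⟨e, he, trivial, trivial, h⟩
  refine ⟨f, hf, trivial, trivial, ?_⟩
  have h3 : ∀ x ∈ K, x ∈ X → ∀ y ∈ K, y ∈ X := fun x hx hxX y hy =>
    by_contra fun h => hK ⟨⟨x, hx, hxX⟩, y, hy, h⟩
  have h4 : ∀ x, x ∉ K → x ∈ X → ∀ y, y ∉ K → y ∈ X := fun x hx hxX y hy =>
    by_contra fun h => hK' ⟨⟨x, hx, hxX⟩, y, hy, h⟩
  grind

/-- If `b` is the only edge of `H` inside `K` that leaves `K'`, then no path in `K` between vertices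
of `K'` needs to leave `K'`. -/
theorem Linked.of_unique_exit {G : MultiGraph V E} {H : Set E} {K K' : Set V} (h : G.Linked H K)
    (hKK : K' ⊆ K) {b : E} {u : V} (hu : u ∈ K') (hbu : G.src b = u ∨ G.tgt b = u)
    (hb : ∀ e ∈ H, G.src e ∈ K → G.tgt e ∈ K → ¬(G.src e ∈ K' ↔ G.tgt e ∈ K') → e = b) :
    G.Linked H K' := by
  have key : ∀ X : Set V, u ∉ X → (∃ a ∈ K', a ∈ X) →
      ∃ e ∈ H, G.src e ∈ K' ∧ G.tgt e ∈ K' ∧ ¬(G.src e ∈ X ↔ G.tgt e ∈ X) := by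
    rintro X hu' ⟨a, haK', haX⟩
    obtain ⟨e, he, h1, h2, h3⟩ := h (K' ∩ X) ⟨a, hKK haK', haK', haX⟩
      ⟨u, hKK hu, fun h => hu' h.2⟩
    have h4 := hb e he h1 h2
    refine ⟨e, he, ?_⟩
    simp only [Set.mem_inter_iff] at h3
    by_cases h5 : G.src e ∈ K' ↔ G.tgt e ∈ K'
    · tauto
    · obtain rfl := h4 h5
      exfalso
      rcases hbu with rfl | rfl <;> tauto
  rintro X ⟨x, hx, hxX⟩ ⟨y, hy, hyX⟩
  by_cases huX : u ∈ X
  · obtain ⟨e, he, h1, h2, h3⟩ := key Xᶜ (fun h => h huX) ⟨y, hy, hyX⟩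
    exact ⟨e, he, h1, h2, fun h => h3 (by simp [h])⟩
  · exact key X huX ⟨x, hx, hxX⟩

/-- If two edges join `w` to a linked set `K'`, neither is a bridge. -/
theorem Linked.erase_of_parallel {G : MultiGraph V E} {H : Set E} {K K' : Set V}
    (h : G.Linked H K) (h' : G.Linked H K') (hKK : K' ⊆ K) {w : V} (hw : w ∈ K)
    (hwK' : w ∉ K') {b b' : E} (hb' : b' ∈ H) (hbb' : b' ≠ b)
    (hbw : G.src b = w ∧ G.tgt b ∈ K' ∨ G.tgt b = w ∧ G.src b ∈ K')
    (hb'w : G.src b' = w ∧ G.tgt b' ∈ K' ∨ G.tgt b' = w ∧ G.src b' ∈ K') :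
    G.Linked {e | e ∈ H ∧ e ≠ b} K := by
  intro X ha hc
  by_cases hX : (∃ a ∈ K', a ∈ X) ∧ ∃ b ∈ K', b ∉ X
  · obtain ⟨e, he, h1, h2, h3⟩ := h' X hX.1 hX.2
    refine ⟨e, ⟨he, ?_⟩, hKK h1, hKK h2, h3⟩
    rintro rfl
    rcases hbw with ⟨rfl, -⟩ | ⟨rfl, -⟩ <;> contradiction
  · obtain ⟨e, he, h1, h2, h3⟩ := h X ha hc
    by_cases heb : e = b
    · subst heb
      have h4 : ∀ x ∈ K', ∀ y ∈ K', x ∈ X → y ∈ X := fun x hx y hy hxX =>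
        by_contra fun h => hX ⟨⟨x, hx, hxX⟩, y, hy, h⟩
      refine ⟨b', ⟨hb', hbb'⟩, ?_⟩
      rcases hbw with ⟨rfl, h5⟩ | ⟨rfl, h5⟩ <;> rcases hb'w with ⟨h6, h7⟩ | ⟨h6, h7⟩ <;>
        rw [h6] <;> refine ⟨by tauto, by tauto, ?_⟩ <;> have h8 := h4 _ h5 _ h7 <;>
        have h9 := h4 _ h7 _ h5 <;> tauto
    · exact ⟨e, ⟨he, heb⟩, h1, h2, h3⟩

/-! ### Chips on edges and chip firing -/

/-- The number of chips at each vertex when every edge of `F` carries one chip, at its end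
`head e`. -/
noncomputable def chips [DecidableEq V] (F : Finset E) (head : E → V) (v : V) : ℤ :=
  ∑ e ∈ F, if head e = v then 1 else 0

/-- The sum of the incoming slopes at `v` of the function that is affine on the edges with values
`h` at the vertices. -/
def lap {R : Type*} [AddCommGroup R] [DecidableEq V] [Fintype E] (G : MultiGraph V E) (h : V → R)
    (v : V) : R :=
  (∑ e : E, if G.tgt e = v then h (G.tgt e) - h (G.src e) else 0) +
    ∑ e : E, if G.src e = v then -(h (G.tgt e) - h (G.src e)) else 0

theorem lap_add {R : Type*} [AddCommGroup R] [DecidableEq V] [Fintype E] (G : MultiGraph V E)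
    (h h' : V → R) (v : V) : G.lap (h + h') v = G.lap h v + G.lap h' v := by
  simp only [lap, ← Finset.sum_add_distrib]
  refine Finset.sum_congr rfl fun e _ => ?_
  split_ifs <;> simp <;> abel

theorem lap_zero {R : Type*} [AddCommGroup R] [DecidableEq V] [Fintype E] (G : MultiGraph V E)
    (v : V) : G.lap (0 : V → R) v = 0 := by
  simp [lap]

theorem sum_lap {R : Type*} [AddCommGroup R] [Fintype V] [DecidableEq V] [Fintype E]
    (G : MultiGraph V E) (h : V → R) : ∑ v, G.lap h v = 0 := by
  simp only [lap, Finset.sum_add_distrib]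
  rw [Finset.sum_comm, Finset.sum_comm (s := Finset.univ (α := V)), ← Finset.sum_add_distrib]
  simp

theorem lap_intCast [DecidableEq V] [Fintype E] (G : MultiGraph V E) (h : V → ℤ) (v : V) :
    G.lap (fun v => (h v : ℝ)) v = (G.lap h v : ℤ) := by
  simp only [lap]
  push_cast
  rfl

/-- Firing the complement of `K`: if no edge outside `F` leaves `K` except `b`, and the chips of
the edges of `F` that leave `K` all lie outside `K`, then these chips together with a chip at the
end `w` of `b` can move across their edges into `K`. -/
theorem chips_fire [DecidableEq V] [Fintype E] (G : MultiGraph V E) (F : Finset E) (head : E → V)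
    (hhead : ∀ e ∈ F, head e = G.src e ∨ head e = G.tgt e) (K : Set V) {w u : V} {b : E}
    (hbF : b ∉ F) (hw : w ∉ K) (hu : u ∈ K)
    (hbe : (G.src b = w ∧ G.tgt b = u) ∨ (G.src b = u ∧ G.tgt b = w))
    (hb : ∀ e ∉ F, ¬(G.src e ∈ K ↔ G.tgt e ∈ K) → e = b)
    (hF : ∀ e ∈ F, ¬(G.src e ∈ K ↔ G.tgt e ∈ K) → head e ∉ K) :
    ∃ (head' : E → V) (ψ : V → ℤ), (∀ e ∈ F, head' e = G.src e ∨ head' e = G.tgt e) ∧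
      ∀ v, chips F head' v + (if u = v then 1 else 0) =
        chips F head v + (if w = v then 1 else 0) + G.lap ψ v := by
  classical
  let ψ : V → ℤ := fun v => if v ∈ K then 1 else 0
  let head' : E → V := fun e => if (G.src e ∈ K ↔ G.tgt e ∈ K) then head e else
    if G.src e ∈ K then G.src e else G.tgt e
  refine ⟨head', ψ, ?_, fun v => ?_⟩
  · intro e he
    have := hhead e he
    simp only [head']
    split_ifs <;> simp [this]
  · have h1 : ∀ hd : E → V, chips F hd v = ∑ e, if e ∈ F then (if hd e = v then 1 else 0) else 0 :=
      fun hd => by simp [chips, Finset.sum_ite_mem]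
    have h2 : ∀ x : V, (if x = v then (1 : ℤ) else 0) =
        ∑ e, if e = b then (if x = v then 1 else 0) else 0 := fun x => by simp
    rw [h1, h1, h2 u, h2 w, lap, ← Finset.sum_add_distrib, ← Finset.sum_add_distrib,
      ← Finset.sum_add_distrib, ← Finset.sum_add_distrib]
    refine Finset.sum_congr rfl fun e _ => ?_
    by_cases heF : e ∈ F
    · have hne : e ≠ b := fun h => hbF (h ▸ heF)
      have := hhead e heF
      have := hF e heF
      simp only [ψ, head', if_pos heF, if_neg hne]
      by_cases hs : G.src e ∈ K <;> by_cases ht : G.tgt e ∈ K <;> simp only [hs, ht] <;> grind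
    · simp only [ψ, if_neg heF]
      by_cases hne : e = b
      · subst hne
        rcases hbe with ⟨h, h'⟩ | ⟨h, h'⟩ <;> simp only [h, h', hw, hu] <;> grind
      · have := fun h => hne (hb e heF h)
        by_cases hs : G.src e ∈ K <;> by_cases ht : G.tgt e ∈ K <;> simp only [hs, ht] <;> grind

theorem ends_of_exit (G : MultiGraph V E) {K : Set V} {w : V} (hw : w ∉ K) {e : E}
    (h : ¬(G.src e ∈ K ↔ G.tgt e ∈ K)) (hew : G.src e = w ∨ G.tgt e = w) :
    G.src e = w ∧ G.tgt e ∈ K ∨ G.tgt e = w ∧ G.src e ∈ K := by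
  rcases hew with rfl | rfl <;> tauto

/-- One more chip. The edges outside `F` connect the graph even without `c`, and a chip is added at
`w`. The chip is driven towards `c` through shrinking sets `K`, which the edges outside `F` leave
only at `w`, until it can be assigned to an edge of its own. -/
theorem exists_chips_add [Finite V] [DecidableEq V] [Fintype E] (G : MultiGraph V E) :
    ∀ (n : ℕ) (K : Set V) (F : Finset E) (head : E → V) (w : V) (c : E), K.ncard ≤ n →
      (∀ e ∈ F, head e = G.src e ∨ head e = G.tgt e) → G.Linked {e | e ∉ F} Set.univ →
      w ∈ K → c ∉ F → G.src c ∈ K → G.tgt c ∈ K → G.Linked {e | e ∉ F} K →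
      G.Linked {e | e ∉ F ∧ e ≠ c} K →
      (∀ e ∉ F, ¬(G.src e ∈ K ↔ G.tgt e ∈ K) → G.src e = w ∨ G.tgt e = w) →
      ∃ (F' : Finset E) (head' : E → V) (ψ : V → ℤ), F'.card = F.card + 1 ∧
        (∀ e ∈ F', head' e = G.src e ∨ head' e = G.tgt e) ∧ G.Linked {e | e ∉ F'} Set.univ ∧
        ∀ v, chips F' head' v = chips F head v + (if w = v then 1 else 0) + G.lap ψ v := by
  classical
  intro n
  induction n with
  | zero =>
    intro K F head w c hn _ _ hw
    exact absurd hw (by simp [(Set.ncard_eq_zero).1 (Nat.le_zero.1 hn)])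
  | succ n ih =>
    intro K F head w c hn hhead hlink hw hcF hcs hct hK hKc hleave
    -- a chip at an end of an edge that may be deleted is assigned to that edge
    have done : ∀ c, c ∉ F → G.src c ∈ K → G.tgt c ∈ K → G.Linked {e | e ∉ F ∧ e ≠ c} K →
        (G.src c = w ∨ G.tgt c = w) →
        ∃ (F' : Finset E) (head' : E → V) (ψ : V → ℤ), F'.card = F.card + 1 ∧
        (∀ e ∈ F', head' e = G.src e ∨ head' e = G.tgt e) ∧ G.Linked {e | e ∉ F'} Set.univ ∧
        ∀ v, chips F' head' v = chips F head v + (if w = v then 1 else 0) + G.lap ψ v := by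
      intro c hcF hcs hct hKc hcw
      refine ⟨insert c F, Function.update head c w, 0, Finset.card_insert_of_notMem hcF, ?_, ?_,
        ?_⟩
      · intro e he
        rcases Finset.mem_insert.1 he with rfl | he'
        · simpa [eq_comm] using hcw
        · rw [Function.update_of_ne (show e ≠ c by rintro rfl; exact hcF he')]
          exact hhead e he'
      · intro X ha hb
        by_cases hX : (∃ a ∈ K, a ∈ X) ∧ ∃ b ∈ K, b ∉ X
        · obtain ⟨e, he, -, -, h⟩ := hKc X hX.1 hX.2
          exact ⟨e, by simpa [not_or, and_comm] using he, trivial, trivial, h⟩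
        · obtain ⟨e, he, h1, h2, h3⟩ := hlink X ha hb
          have : e ≠ c := by rintro rfl; grind
          exact ⟨e, by simpa [this] using he, h1, h2, h3⟩
      · intro v
        have h : ∑ e ∈ F, (if Function.update head c w e = v then (1 : ℤ) else 0) =
            ∑ e ∈ F, if head e = v then (1 : ℤ) else 0 := by
          refine Finset.sum_congr rfl fun e he => ?_
          rw [Function.update_of_ne (show e ≠ c by rintro rfl; exact hcF he)]
        simp [chips, Finset.sum_insert hcF, lap_zero, h, add_comm]
    by_cases hcw : G.src c = w ∨ G.tgt c = w
    · exact done c hcF hcs hct hKc hcw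
    push Not at hcw
    obtain ⟨K', hK'K, hcK', hK', hcl⟩ := G.exists_linked_component {e | e ∉ F} (K \ {w})
      (a := G.src c) ⟨hcs, hcw.1⟩
    have hcK'' : G.tgt c ∈ K' := (hcl c hcF ⟨hcs, hcw.1⟩ ⟨hct, hcw.2⟩).1 hcK'
    have hwK' : w ∉ K' := fun h => (hK'K h).2 rfl
    -- only edges at `w` leave the component `K'` of `c`
    have hleave' : ∀ e ∉ F, ¬(G.src e ∈ K' ↔ G.tgt e ∈ K') → G.src e = w ∨ G.tgt e = w := by
      intro e he h
      by_contra! hew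
      by_cases h' : G.src e ∈ K ↔ G.tgt e ∈ K
      · refine h ⟨fun h1 => ?_, fun h1 => ?_⟩
        · exact (hcl e he (hK'K h1) ⟨h'.1 (hK'K h1).1, hew.2⟩).1 h1
        · exact (hcl e he ⟨h'.2 (hK'K h1).1, hew.1⟩ (hK'K h1)).2 h1
      · exact (hleave e he h').elim hew.1 hew.2
    obtain ⟨b, hbF, hbs, hbt, hb⟩ := hK K' ⟨_, hcs, hcK'⟩ ⟨w, hw, hwK'⟩
    have hbw := hleave' b hbF hb
    -- two edges from `w` to `K'` are not bridges
    by_cases hb2 : ∃ b', b' ∉ F ∧ b' ≠ b ∧ ¬(G.src b' ∈ K' ↔ G.tgt b' ∈ K')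
    · obtain ⟨b', hb'F, hb'b, hb'⟩ := hb2
      have hb'w := hleave' b' hb'F hb'
      exact done b hbF hbs hbt (hK.erase_of_parallel hK' (fun v hv => (hK'K hv).1) hw hwK' hb'F
        hb'b (G.ends_of_exit hwK' hb hbw) (G.ends_of_exit hwK' hb' hb'w)) hbw
    · push Not at hb2
      have hbuniq : ∀ e ∉ F, ¬(G.src e ∈ K' ↔ G.tgt e ∈ K') → e = b := by
        intro e he h
        by_contra hne
        exact h (hb2 e he hne)
      obtain ⟨u, huK', hbe⟩ : ∃ u ∈ K', (G.src b = w ∧ G.tgt b = u) ∨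
          (G.src b = u ∧ G.tgt b = w) := by
        rcases G.ends_of_exit hwK' hb hbw with ⟨h, h'⟩ | ⟨h, h'⟩
        · exact ⟨G.tgt b, h', Or.inl ⟨h, rfl⟩⟩
        · exact ⟨G.src b, h', Or.inr ⟨rfl, h⟩⟩
      have hbu : G.src b = u ∨ G.tgt b = u := hbe.elim (fun h => Or.inr h.2) fun h => Or.inl h.1
      have hbK' : ∀ e, G.src e ∈ K' → G.tgt e ∈ K' → e ≠ b := by
        rintro e h1 h2 rfl
        exact hb ⟨fun _ => h2, fun _ => h1⟩
      have hlt : K'.ncard ≤ n := by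
        have : K'.ncard < K.ncard :=
          Set.ncard_lt_ncard ⟨fun v hv => (hK'K hv).1, fun h => hwK' (h hw)⟩
        omega
      -- `b` is the only edge of `H` leaving `K'`, so deleting `c` does not disconnect `K'`
      have hK'c : G.Linked {e | e ∉ F ∧ e ≠ c} K' :=
        hKc.of_unique_exit (fun v hv => (hK'K hv).1) huK' hbu
          fun e he _ _ h => hbuniq e he.1 h
      by_cases hF : ∀ e ∈ F, ¬(G.src e ∈ K' ↔ G.tgt e ∈ K') → head e ∉ K'
      · obtain ⟨head', ψ, hhead', hψ⟩ :=
          G.chips_fire F head hhead K' hbF hwK' huK' hbe hbuniq hF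
        obtain ⟨F'', head'', ψ', h1, h2, h3, h4⟩ := ih K' F head' u c hlt hhead' hlink huK' hcF
          hcK' hcK'' hK' hK'c (by
            intro e he h
            rw [hbuniq e he h]
            exact hbu)
        refine ⟨F'', head'', ψ' + ψ, h1, h2, h3, fun v => ?_⟩
        rw [h4, hψ, lap_add]
        ring
      · -- an edge `f` of `F` whose chip `x` lies in `K'` is exchanged for `b`
        simp only [not_forall, not_not] at hF
        obtain ⟨f, hfF, hf, hx⟩ := hF
        have hbf : b ≠ f := fun h => hbF (h ▸ hfF)
        let F₁ : Finset E := insert b (F.erase f)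
        have hmem : ∀ e, e ∉ F₁ ↔ (e ∉ F ∨ e = f) ∧ e ≠ b := by
          intro e
          simp only [F₁, Finset.mem_insert, Finset.mem_erase, not_or, not_and_or, not_not]
          rw [and_comm, or_comm (a := e = f)]
        have hcb : c ≠ b := hbK' c hcK' hcK''
        have hb1 : b ∉ F.erase f := fun h => hbF (Finset.mem_of_mem_erase h)
        have hcard : F₁.card = F.card := by
          rw [Finset.card_insert_of_notMem hb1, Finset.card_erase_add_one hfF]
        have hS : G.Linked {e | e ∉ F₁} K'ᶜ := by
          refine Linked.mono (hlink.of_unique_exit (Set.subset_univ K'ᶜ) hwK' hbw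
            fun e he _ _ h => hbuniq e he fun h' => h (not_congr h')) fun e he h1 h2 =>
              (hmem e).2 ⟨Or.inl he, ?_⟩
          rintro rfl
          exact hb ⟨fun h => absurd h h1, fun h => absurd h h2⟩
        have hK'₁ : G.Linked {e | e ∉ F₁} K' := hK'.mono fun e he h1 h2 =>
          (hmem e).2 ⟨Or.inl he, hbK' e h1 h2⟩
        have hlink₁ : G.Linked {e | e ∉ F₁} Set.univ :=
          hK'₁.univ_of_compl hS ((hmem f).2 ⟨Or.inr rfl, hbf.symm⟩) hf
        obtain ⟨F'', head'', ψ', h1, h2, h3, h4⟩ := ih K' F₁ (Function.update head b w) (head f) c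
          hlt (by
            intro e he
            rcases Finset.mem_insert.1 he with rfl | he'
            · simpa [eq_comm] using hbw
            · rw [Function.update_of_ne (show e ≠ b by rintro rfl; exact hb1 he')]
              exact hhead e (Finset.mem_of_mem_erase he')) hlink₁ hx
            ((hmem c).2 ⟨Or.inl hcF, hcb⟩) hcK' hcK'' hK'₁ (hK'c.mono fun e he h1 h2 =>
              ⟨(hmem e).2 ⟨Or.inl he.1, hbK' e h1 h2⟩, he.2⟩) (by
            intro e he h
            have he' := (hmem e).1 he
            have : e = f := by
              rcases he'.1 with h' | h'
              · exact absurd (hbuniq e h' h) he'.2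
              · exact h'
            rw [this]
            exact (hhead f hfF).imp Eq.symm Eq.symm)
        refine ⟨F'', head'', ψ', h1.trans (by rw [hcard]), h2, h3, fun v => ?_⟩
        rw [h4]
        have h5 : ∑ e ∈ F.erase f, (if Function.update head b w e = v then (1 : ℤ) else 0) =
            ∑ e ∈ F.erase f, if head e = v then (1 : ℤ) else 0 := by
          refine Finset.sum_congr rfl fun e he => ?_
          rw [Function.update_of_ne (show e ≠ b by rintro rfl; exact hb1 he)]
        have h6 := Finset.sum_erase_add F (fun e => if head e = v then (1 : ℤ) else 0) hfF
        simp only [chips, F₁, Finset.sum_insert hb1, h5, Function.update_self]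
        rw [← h6]
        ring

/-! ### Rooted spanning trees -/

/-- A rooted spanning tree of `G`: every vertex `v` other than the root has a parent `par v`, joined
to `v` by the edge `edge v`. The set `anc v` consists of the vertices on the path from the root to
`v`, without the root; it carries the well-foundedness of the parent function. -/
structure RootedTree [DecidableEq V] (G : MultiGraph V E) where
  root : V
  par : V → V
  edge : {v // v ≠ root} → E
  anc : V → Finset V
  anc_root : anc root = ∅
  anc_eq : ∀ v, v ≠ root → anc v = insert v (anc (par v))
  notMem_anc_par : ∀ v, v ≠ root → v ∉ anc (par v)
  ends : ∀ v, (G.src (edge v) = par v ∧ G.tgt (edge v) = v) ∨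
    (G.src (edge v) = v ∧ G.tgt (edge v) = par v)

/-- A linked graph has a rooted spanning tree, grown from a root one edge at a time. -/
theorem Linked.exists_rootedTree [Finite V] [Nonempty V] [DecidableEq V] {G : MultiGraph V E}
    {H : Set E} (h : G.Linked H Set.univ) : ∃ T : G.RootedTree, ∀ v, T.edge v ∈ H := by
  classical
  obtain ⟨r⟩ := ‹Nonempty V›
  have key : ∀ n < Nat.card V, ∃ X : Set V, X.ncard = n + 1 ∧ r ∈ X ∧
      ∃ (par : V → V) (A : V → Finset V), A r = ∅ ∧ (∀ v ∈ X, ∀ u ∈ A v, u ∈ X) ∧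
        ∀ v ∈ X, v ≠ r → par v ∈ X ∧ v ∉ A (par v) ∧ A v = insert v (A (par v)) ∧
          ∃ e ∈ H, (G.src e = par v ∧ G.tgt e = v) ∨ (G.src e = v ∧ G.tgt e = par v) := by
    intro n
    induction n with
    | zero =>
      intro _
      exact ⟨{r}, by simp, rfl, id, fun _ => ∅, rfl, by simp,
        fun v hv hne => absurd hv hne⟩
    | succ n ih =>
      intro hn
      obtain ⟨X, hX, hr, par, A, hA, hAX, hpar⟩ := ih (by omega)
      obtain ⟨b, hb⟩ : ∃ b, b ∉ X := by
        by_contra! hall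
        rw [Set.eq_univ_of_forall hall, Set.ncard_univ] at hX
        omega
      obtain ⟨e, he, -, -, hcr⟩ := h X ⟨r, trivial, hr⟩ ⟨b, trivial, hb⟩
      obtain ⟨x, y, hx, hy, hxy⟩ : ∃ x y, x ∈ X ∧ y ∉ X ∧
          ((G.src e = x ∧ G.tgt e = y) ∨ (G.src e = y ∧ G.tgt e = x)) := by
        by_cases hs : G.src e ∈ X
        · exact ⟨_, _, hs, fun h => hcr ⟨fun _ => h, fun _ => hs⟩, Or.inl ⟨rfl, rfl⟩⟩
        · exact ⟨_, _, by tauto, hs, Or.inr ⟨rfl, rfl⟩⟩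
      have hry : r ≠ y := by rintro rfl; exact hy hr
      have hne : ∀ v ∈ X, v ≠ y := by rintro v hv rfl; exact hy hv
      refine ⟨insert y X, by rw [Set.ncard_insert_of_notMem hy, hX], Or.inr hr,
        Function.update par y x, Function.update A y (insert y (A x)), ?_, ?_, ?_⟩
      · rw [Function.update_of_ne hry, hA]
      · rintro v (rfl | hv) u hu
        · rw [Function.update_self, Finset.mem_insert] at hu
          exact hu.imp_right (hAX x hx u)
        · rw [Function.update_of_ne (hne v hv)] at hu
          exact Or.inr (hAX v hv u hu)
      · rintro v (rfl | hv) hvr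
        · rw [Function.update_self, Function.update_of_ne (hne x hx), Function.update_self]
          exact ⟨Or.inr hx, fun h => hy (hAX x hx _ h), rfl, e, he, hxy⟩
        · obtain ⟨h1, h2, h3, h4⟩ := hpar v hv hvr
          rw [Function.update_of_ne (hne v hv), Function.update_of_ne (hne _ h1),
            Function.update_of_ne (hne v hv)]
          exact ⟨Or.inr h1, h2, h3, h4⟩
  have hpos : 0 < Nat.card V := Nat.card_pos_iff.2 ⟨⟨r⟩, inferInstance⟩
  obtain ⟨X, hX, -, par, A, hA, -, hpar⟩ := key (Nat.card V - 1) (by omega)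
  have huniv : X = Set.univ := Set.eq_of_subset_of_ncard_le (Set.subset_univ X)
    (by rw [Set.ncard_univ]; omega)
  subst huniv
  choose e heH hends using fun v : {v // v ≠ r} => (hpar v trivial v.2).2.2.2
  exact ⟨⟨r, par, e, A, hA, fun v hv => (hpar v trivial hv).2.2.1,
    fun v hv => (hpar v trivial hv).2.1, hends⟩, heH⟩

namespace RootedTree

variable [DecidableEq V] {G : MultiGraph V E} (T : G.RootedTree)

theorem card_anc {v : V} (hv : v ≠ T.root) : (T.anc v).card = (T.anc (T.par v)).card + 1 := by
  rw [T.anc_eq v hv, Finset.card_insert_of_notMem (T.notMem_anc_par v hv)]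

theorem par_induction {P : V → Prop} (h0 : P T.root)
    (h1 : ∀ v, v ≠ T.root → P (T.par v) → P v) (v : V) : P v := by
  induction hn : (T.anc v).card using Nat.strong_induction_on generalizing v with
  | _ n ih =>
    by_cases hv : v = T.root
    · exact hv ▸ h0
    · exact h1 v hv (ih _ (by rw [← hn, T.card_anc hv]; omega) _ rfl)

theorem root_notMem_anc (v : V) : T.root ∉ T.anc v := by
  induction v using T.par_induction with
  | h0 => simp [T.anc_root]
  | h1 v hv ih => simp [T.anc_eq v hv, ih, Ne.symm hv]

theorem self_mem_anc {v : V} (hv : v ≠ T.root) : v ∈ T.anc v := by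
  simp [T.anc_eq v hv]

theorem anc_subset {u v : V} (h : u ∈ T.anc v) : T.anc u ⊆ T.anc v := by
  induction v using T.par_induction with
  | h0 => simp [T.anc_root] at h
  | h1 v hv ih =>
    rw [T.anc_eq v hv, Finset.mem_insert] at h
    rcases h with rfl | h
    · rfl
    · rw [T.anc_eq v hv]
      exact (ih h).trans (Finset.subset_insert _ _)

theorem anc_injective : Function.Injective T.anc := by
  intro u v huv
  by_cases hv : v = T.root
  · by_contra hne
    have := T.self_mem_anc (v := u) (by rintro rfl; exact hne hv.symm)
    rw [huv, hv, T.anc_root] at this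
    simp at this
  · have h := T.self_mem_anc hv
    have hu : u ≠ T.root := by
      rintro rfl
      rw [← huv, T.anc_root] at h
      simp at h
    rw [← huv, T.anc_eq u hu, Finset.mem_insert] at h
    rcases h with h | h
    · exact h.symm
    · have h1 := Finset.card_le_card (T.anc_subset h)
      have h2 := T.card_anc hu
      rw [huv] at h2
      omega

theorem edge_injective : Function.Injective T.edge := by
  rintro ⟨u, hu⟩ ⟨v, hv⟩ huv
  have h1 := T.ends ⟨u, hu⟩
  have h2 := T.ends ⟨v, hv⟩
  rw [huv] at h1
  have h3 := T.card_anc hu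
  have h4 := T.card_anc hv
  simp only [Subtype.mk.injEq]
  rcases h1 with ⟨h, h'⟩ | ⟨h, h'⟩ <;> rcases h2 with ⟨k, k'⟩ | ⟨k, k'⟩ <;>
    rw [k] at h <;> rw [k'] at h' <;> simp only at h h' <;>
    first | exact h.symm | exact h'.symm | (exfalso; rw [h] at h4; rw [← h'] at h3; omega) |
      (exfalso; rw [h'] at h4; rw [← h] at h3; omega)

theorem ncard_range_edge [Fintype V] : (Set.range T.edge).ncard + 1 = Fintype.card V := by
  rw [← Set.image_univ, Set.ncard_image_of_injective _ T.edge_injective, Set.ncard_univ,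
    Nat.card_eq_fintype_card, Fintype.card_subtype_compl, Fintype.card_subtype_eq]
  have := Fintype.card_pos_iff.2 ⟨T.root⟩
  omega

theorem linked_range_edge : G.Linked (Set.range T.edge) Set.univ := by
  rintro X ⟨a, -, ha⟩ ⟨b, -, hb⟩
  by_contra! hno
  have h : ∀ v, v ∈ X ↔ T.root ∈ X := by
    intro v
    induction v using T.par_induction with
    | h0 => rfl
    | h1 v hv ih =>
      have h1 := hno (T.edge ⟨v, hv⟩) ⟨_, rfl⟩ trivial trivial
      rcases T.ends ⟨v, hv⟩ with ⟨h, h'⟩ | ⟨h, h'⟩ <;> rw [h, h'] at h1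
      · exact h1.symm.trans ih
      · exact h1.trans ih
  exact hb ((h b).2 ((h a).1 ha))

end RootedTree

/-! ### Integral representatives with chips on independent edges -/

/-- Every effective divisor `D` of degree at most the genus on the vertices is equivalent, through
an integral function on the vertices, to a divisor whose chips can be assigned to distinct incident
edges that do not disconnect the graph when deleted together. -/
theorem Linked.exists_chips [Fintype V] [DecidableEq V] [Nonempty V] [Fintype E]
    {G : MultiGraph V E} (hG : G.Linked Set.univ Set.univ) :
    ∀ (d : ℕ), d ≤ G.genus → ∀ D : V → ℤ, (∀ v, 0 ≤ D v) → ∑ v, D v = d →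
      ∃ (F : Finset E) (head : E → V) (ψ : V → ℤ), F.card = d ∧
        (∀ e ∈ F, head e = G.src e ∨ head e = G.tgt e) ∧ G.Linked {e | e ∉ F} Set.univ ∧
        ∀ v, chips F head v = D v + G.lap ψ v := by
  classical
  intro d
  induction d with
  | zero =>
    intro _ D hD hsum
    rw [Nat.cast_zero, Finset.sum_eq_zero_iff_of_nonneg (fun v _ => hD v)] at hsum
    refine ⟨∅, G.src, 0, rfl, by simp, hG.mono (by simp), fun v => ?_⟩
    simp [chips, lap_zero, hsum v (Finset.mem_univ v)]
  | succ d ih =>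
    intro hd D hD hsum
    obtain ⟨w, hw⟩ : ∃ w, 0 < D w := by
      by_contra! hle
      have := Finset.sum_nonpos (fun v (_ : v ∈ Finset.univ) => hle v)
      push_cast at hsum
      omega
    obtain ⟨F, head, ψ, hcard, hhead, hlink, hchips⟩ := ih (by omega)
      (fun v => D v - if w = v then 1 else 0) (fun v => by
        have := hD v
        split_ifs with h
        · subst h; omega
        · omega) (by
        rw [Finset.sum_sub_distrib, hsum]
        simp)
    obtain ⟨T, hT⟩ := hlink.exists_rootedTree
    -- the edges outside `F` are too many for a tree
    obtain ⟨c, hcF, hcT⟩ : ∃ c ∈ {e | e ∉ F}, c ∉ Set.range T.edge := by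
      by_contra! hsub
      have h1 := Set.ncard_le_ncard (show {e | e ∉ F} ⊆ Set.range T.edge from hsub)
      have h2 := T.ncard_range_edge
      have h3 : {e | e ∉ F} = ((Fᶜ : Finset E) : Set E) := by ext; simp
      rw [h3, Set.ncard_coe_finset, Finset.card_compl, hcard] at h1
      have h4 := Finset.card_le_univ F
      simp only [genus] at hd
      omega
    obtain ⟨F', head', ψ', h1, h2, h3, h4⟩ := G.exists_chips_add _ Set.univ F head w c le_rfl hhead
      hlink trivial hcF trivial trivial hlink
      (T.linked_range_edge.mono (by
        rintro e ⟨v, rfl⟩ - -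
        exact ⟨hT v, fun h => hcT ⟨v, h⟩⟩)) (by simp)
    refine ⟨F', head', ψ + ψ', by omega, h2, h3, fun v => ?_⟩
    rw [h4, hchips, lap_add]
    ring

section

variable (G : MultiGraph V E)

/-! ### The topology of the metric graph -/

theorem edgePath_zero (e : E) : G.edgePath e ⟨0, by simp⟩ = .vertex (G.src e) := by
  simp [edgePath]

theorem edgePath_one (e : E) : G.edgePath e ⟨1, by simp⟩ = .vertex (G.tgt e) := by
  simp [edgePath]

theorem edgePath_inner (e : E) (t : Ioo (0 : ℝ) 1) :
    G.edgePath e ⟨t, Ioo_subset_Icc_self t.2⟩ = .inner e t := by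
  simp [edgePath, t.2.1.ne', t.2.2.ne]

theorem edgePath_of_mem_Ioo (e : E) (t : Icc (0 : ℝ) 1) (ht : (t : ℝ) ∈ Ioo (0 : ℝ) 1) :
    G.edgePath e t = .inner e ⟨t, ht⟩ :=
  G.edgePath_inner e ⟨t, ht⟩

theorem isOpen_iff_edgePath {s : Set G.Point} :
    IsOpen s ↔ ∀ e, IsOpen (G.edgePath e ⁻¹' s) := by
  unfold instTopologicalSpacePoint
  simp only [isOpen_iSup_iff, isOpen_coinduced]

theorem continuous_iff_edgePath {Y : Type*} [TopologicalSpace Y] {f : G.Point → Y} :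
    Continuous f ↔ ∀ e, Continuous fun t => f (G.edgePath e t) := by
  unfold instTopologicalSpacePoint
  simp only [continuous_iSup_dom, continuous_coinduced_dom]
  rfl

theorem continuous_edgePath (e : E) : Continuous (G.edgePath e) :=
  continuous_def.2 fun _ hs => (G.isOpen_iff_edgePath.1 hs) e

/-- The function on the metric graph with values `h` at the vertices that is `f e` on the interior
of each edge `e`. -/
def glue {Y : Type*} (h : V → Y) (f : E → ℝ → Y) : G.Point → Y
  | .vertex v => h v
  | .inner e t => f e t

theorem glue_edgePath {Y : Type*} {h : V → Y} {f : E → ℝ → Y} (h0 : ∀ e, f e 0 = h (G.src e))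
    (h1 : ∀ e, f e 1 = h (G.tgt e)) (e : E) (t : Icc (0 : ℝ) 1) :
    G.glue h f (G.edgePath e t) = f e t := by
  unfold edgePath
  split_ifs with ht ht'
  · rw [ht, h0, glue]
  · rw [ht', h1, glue]
  · rfl

theorem continuous_glue {Y : Type*} [TopologicalSpace Y] {h : V → Y} {f : E → ℝ → Y}
    (h0 : ∀ e, f e 0 = h (G.src e)) (h1 : ∀ e, f e 1 = h (G.tgt e)) (hf : ∀ e, Continuous (f e)) :
    Continuous (G.glue h f) :=
  G.continuous_iff_edgePath.2 fun e => by
    simp only [G.glue_edgePath h0 h1]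
    exact (hf e).comp continuous_subtype_val

/-! ### Piecewise affine functions -/

theorem onEdge_of_mem (φ : G.Point → ℝ) (e : E) {t : ℝ} (ht : t ∈ Icc (0 : ℝ) 1) :
    onEdge φ e t = φ (G.edgePath e ⟨t, ht⟩) :=
  IccExtend_of_mem _ _ ht

theorem onEdge_zero (φ : G.Point → ℝ) (e : E) : onEdge φ e 0 = φ (.vertex (G.src e)) := by
  rw [onEdge_of_mem G φ e (by simp), edgePath_zero]

theorem onEdge_one (φ : G.Point → ℝ) (e : E) : onEdge φ e 1 = φ (.vertex (G.tgt e)) := by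
  rw [onEdge_of_mem G φ e (by simp), edgePath_one]

/-- The function on the metric graph with values `h` at the vertices that is affine on the
edges. -/
def interp (h : V → ℝ) : G.Point → ℝ :=
  G.glue h fun e t => h (G.src e) + (h (G.tgt e) - h (G.src e)) * t

theorem onEdge_interp (h : V → ℝ) (e : E) {t : ℝ} (ht : t ∈ Icc (0 : ℝ) 1) :
    onEdge (G.interp h) e t = h (G.src e) + (h (G.tgt e) - h (G.src e)) * t := by
  rw [onEdge_of_mem G _ e ht, interp, G.glue_edgePath (by simp) (by simp)]

theorem continuous_interp (h : V → ℝ) : Continuous (G.interp h) :=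
  G.continuous_glue (by simp) (by simp) fun e => by fun_prop

theorem derivWithin_Iic_of_affine {f : ℝ → ℝ} {a b c k : ℝ} (hab : a < b)
    (h : ∀ t ∈ Icc a b, f t = c + k * t) : derivWithin f (Iic b) b = k := by
  have h1 : HasDerivWithinAt (fun t => c + k * t) k (Iic b) b := by
    simpa using (((hasDerivAt_id b).const_mul k).const_add c).hasDerivWithinAt
  refine HasDerivWithinAt.derivWithin (h1.congr_of_eventuallyEq ?_ (h b ⟨hab.le, le_rfl⟩))
    (uniqueDiffWithinAt_Iic b)
  filter_upwards [Icc_mem_nhdsLE hab] with t ht using h t ht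

theorem derivWithin_Ici_of_affine {f : ℝ → ℝ} {a b c k : ℝ} (hab : a < b)
    (h : ∀ t ∈ Icc a b, f t = c + k * t) : derivWithin f (Ici a) a = k := by
  have h1 : HasDerivWithinAt (fun t => c + k * t) k (Ici a) a := by
    simpa using (((hasDerivAt_id a).const_mul k).const_add c).hasDerivWithinAt
  refine HasDerivWithinAt.derivWithin (h1.congr_of_eventuallyEq ?_ (h a ⟨le_rfl, hab.le⟩))
    (uniqueDiffWithinAt_Ici a)
  filter_upwards [Icc_mem_nhdsGE hab] with t ht using h t ht

/-- A piecewise affine function with integer slopes whose slope on `(0, 1)` only changes at `τ`,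
where it drops by `c`. -/
theorem IsPiecewiseAffine.eq_of_jump {f : ℝ → ℝ} (hf : IsPiecewiseAffine f) {τ c : ℝ}
    (hτ : 0 < τ)
    (hjump : ∀ t ∈ Ioo (0 : ℝ) 1,
      derivWithin f (Iic t) t - derivWithin f (Ici t) t = if t = τ then c else 0) :
    ∃ m : ℤ, ∀ t ∈ Icc (0 : ℝ) 1, f t = f 0 + m * t - c * max (t - τ) 0 := by
  obtain ⟨n, x, m, hx, hx0, hx1, hfx⟩ := hf
  have hn : 0 < n := by
    rcases Nat.eq_zero_or_pos n with rfl | h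
    · rw [show Fin.last 0 = 0 from rfl, hx0] at hx1
      norm_num at hx1
    · exact h
  have hform : ∀ i : Fin n, ∀ t ∈ Icc (x i.castSucc) (x i.succ),
      f t = (f (x i.castSucc) - m i * x i.castSucc) + m i * t := fun i t ht => by
    rw [hfx i t ht]; ring
  have hlt : ∀ i : Fin n, x i.castSucc < x i.succ := fun i => hx i.castSucc_lt_succ
  have hnn : ∀ i, 0 ≤ x i := fun i => hx0 ▸ hx.monotone (Fin.zero_le i)
  have hle : ∀ i, x i ≤ 1 := fun i => hx1 ▸ hx.monotone (Fin.le_last i)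
  have key : ∀ (i : ℕ) (hi : i < n),
      (m ⟨i, hi⟩ : ℝ) = m ⟨0, hn⟩ - (if τ ≤ x (Fin.castSucc ⟨i, hi⟩) then c else 0) ∧
      ∀ t ∈ Icc 0 (x (Fin.succ ⟨i, hi⟩)), f t = f 0 + m ⟨0, hn⟩ * t - c * max (t - τ) 0 := by
    intro i
    induction i with
    | zero =>
      intro hi
      have h0 : x (Fin.castSucc ⟨0, hi⟩) = 0 := hx0
      rw [h0, if_neg hτ.not_ge]
      refine ⟨by simp, fun t ht => ?_⟩
      have h1 := hform ⟨0, hi⟩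
      have h2 := hlt ⟨0, hi⟩
      rw [h0] at h1 h2
      rw [h1 t ht]
      by_cases hτx : x (Fin.succ ⟨0, hi⟩) ≤ τ
      · rw [max_eq_right (by linarith [ht.2])]
        ring
      · push Not at hτx
        -- the slope does not change within a piece
        have h3 := hjump τ ⟨hτ, hτx.trans_le (hle _)⟩
        rw [if_pos rfl, derivWithin_Iic_of_affine hτ fun s hs => h1 s ⟨hs.1, hs.2.trans hτx.le⟩,
          derivWithin_Ici_of_affine hτx fun s hs => h1 s ⟨hτ.le.trans hs.1, hs.2⟩] at h3
        rw [← h3]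
        ring
    | succ i ih =>
      intro hi
      obtain ⟨ih1, ih2⟩ := ih (by omega)
      have hxi : x (Fin.succ ⟨i, by omega⟩) = x (Fin.castSucc ⟨i + 1, hi⟩) := rfl
      rw [hxi] at ih2
      have h1 := hform ⟨i + 1, hi⟩
      have h2 := hlt ⟨i + 1, hi⟩
      have h1' := hform ⟨i, by omega⟩
      have h2' := hlt ⟨i, by omega⟩
      rw [hxi] at h1' h2'
      have hy0 := hnn (Fin.castSucc ⟨i, by omega⟩)
      have hz1 := hle (Fin.succ ⟨i + 1, hi⟩)
      set y := x (Fin.castSucc ⟨i + 1, hi⟩) with hy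
      set z := x (Fin.succ ⟨i + 1, hi⟩) with hz
      have hpos : 0 < y := hy0.trans_lt h2'
      have hj := hjump y ⟨hpos, h2.trans_le hz1⟩
      rw [derivWithin_Iic_of_affine h2' h1', derivWithin_Ici_of_affine h2 h1] at hj
      have hsplit : c = 0 ∨ τ ≤ x (Fin.castSucc ⟨i, by omega⟩) ∨ y ≤ τ := by
        by_contra! hcon
        have h3 := hjump τ ⟨hτ, hcon.2.2.trans (h2.trans_le hz1)⟩
        rw [if_pos rfl,
          derivWithin_Iic_of_affine hcon.2.1 fun s hs => h1' s ⟨hs.1, hs.2.trans hcon.2.2.le⟩,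
          derivWithin_Ici_of_affine hcon.2.2 fun s hs => h1' s ⟨hcon.2.1.le.trans hs.1, hs.2⟩,
          sub_self] at h3
        exact hcon.1 h3.symm
      have hsplit' : c = 0 ∨ τ ≤ y ∨ z ≤ τ := by
        by_contra! hcon
        have h3 := hjump τ ⟨hτ, hcon.2.2.trans_le hz1⟩
        rw [if_pos rfl,
          derivWithin_Iic_of_affine hcon.2.1 fun s hs => h1 s ⟨hs.1, hs.2.trans hcon.2.2.le⟩,
          derivWithin_Ici_of_affine hcon.2.2 fun s hs => h1 s ⟨hcon.2.1.le.trans hs.1, hs.2⟩,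
          sub_self] at h3
        exact hcon.1 h3.symm
      have hm : (m ⟨i + 1, hi⟩ : ℝ) = m ⟨0, hn⟩ - (if τ ≤ y then c else 0) := by
        rcases hsplit with h | h | h
        · subst h
          simp only [ite_self, sub_zero] at hj ih1 ⊢
          linarith
        · rw [if_pos h] at ih1
          rw [if_neg (by linarith)] at hj
          rw [if_pos (by linarith)]
          linarith
        · rw [if_neg (by linarith)] at ih1
          by_cases hyτ : y = τ
          · rw [if_pos hyτ] at hj
            rw [if_pos hyτ.ge]
            linarith
          · rw [if_neg hyτ] at hj
            rw [if_neg fun h' => hyτ (le_antisymm h h')]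
            linarith
      refine ⟨hm, fun t ht => ?_⟩
      rcases le_total t y with hty | hty
      · exact ih2 t ⟨ht.1, hty⟩
      · rw [h1 t ⟨hty, ht.2⟩, ih2 y ⟨hpos.le, le_rfl⟩, hm]
        rcases hsplit' with h | h | h
        · subst h
          simp
        · rw [if_pos h, max_eq_left (by linarith), max_eq_left (by linarith)]
          ring
        · rw [if_neg (by linarith), max_eq_right (by linarith), max_eq_right (by linarith [ht.2])]
          ring
  obtain ⟨k, rfl⟩ : ∃ k, n = k + 1 := ⟨n - 1, by omega⟩
  refine ⟨m ⟨0, hn⟩, fun t ht => (key k (by omega)).2 t ⟨ht.1, ht.2.trans hx1.ge⟩⟩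

/-- A piecewise affine function with integer slopes whose slope does not change on `(0, 1)`. -/
theorem IsPiecewiseAffine.eq_of_no_jump {f : ℝ → ℝ} (hf : IsPiecewiseAffine f)
    (hjump : ∀ t ∈ Ioo (0 : ℝ) 1, derivWithin f (Iic t) t - derivWithin f (Ici t) t = 0) :
    ∃ m : ℤ, ∀ t ∈ Icc (0 : ℝ) 1, f t = f 0 + m * t := by
  obtain ⟨m, hm⟩ := hf.eq_of_jump (τ := 1) (c := 0) one_pos (by simpa using hjump)
  exact ⟨m, fun t ht => by rw [hm t ht]; ring⟩

/-! ### Linear equivalence and integral divisors -/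

theorem IsIntegral.apply_inner {D : G.Div} (hD : IsIntegral D) (e : E) (t : Ioo (0 : ℝ) 1) :
    D (.inner e t) = 0 := by
  by_contra h
  obtain ⟨v, hv⟩ := hD _ (Finsupp.mem_support_iff.2 h)
  cases hv

theorem isRational_interp {G : MultiGraph V E} {h : V → ℝ} (hh : ∀ e, ∃ k : ℤ, h (G.tgt e) - h (G.src e) = k) :
    IsRational (G.interp h) := by
  refine ⟨G.continuous_interp h, fun e => ?_⟩
  obtain ⟨k, hk⟩ := hh e
  refine ⟨1, ![0, 1], ![k], ?_, rfl, rfl, ?_⟩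
  · rw [Fin.strictMono_iff_lt_succ]
    intro i
    fin_cases i
    simp
  · intro i t ht
    fin_cases i
    simp only [Fin.zero_eta, Fin.isValue, Fin.castSucc_zero, Matrix.cons_val_zero,
      Fin.succ_zero_eq_one, Matrix.cons_val_one] at ht ⊢
    rw [G.onEdge_interp h e ht, G.onEdge_interp h e (by simp), hk]
    ring

section LinEquiv

variable [DecidableEq V] [Fintype E] {G}

/-- The divisor of a function that is affine on the edges. -/
theorem incomingSlopes_of_affine {φ : G.Point → ℝ} {h : V → ℝ}
    (hφ : ∀ e, ∀ t ∈ Icc (0 : ℝ) 1,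
      onEdge φ e t = h (G.src e) + (h (G.tgt e) - h (G.src e)) * t) (p : G.Point) :
    incomingSlopes φ p = match p with
      | .vertex v => G.lap h v
      | .inner _ _ => 0 := by
  cases p with
  | vertex v =>
    simp only [incomingSlopes, lap, derivWithin_Iic_of_affine one_pos (hφ _),
      derivWithin_Ici_of_affine one_pos (hφ _)]
  | inner e t =>
    simp only [incomingSlopes]
    rw [derivWithin_Iic_of_affine t.2.1 fun s hs => hφ e s ⟨hs.1, hs.2.trans t.2.2.le⟩,
      derivWithin_Ici_of_affine t.2.2 fun s hs => hφ e s ⟨t.2.1.le.trans hs.1, hs.2⟩, sub_self]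

/-- On integral divisors, linear equivalence only involves functions that are affine on the
edges. -/
theorem linEquiv_iff_of_isIntegral {D₁ D₂ : G.Div} (h₁ : IsIntegral D₁) (h₂ : IsIntegral D₂) :
    LinEquiv D₁ D₂ ↔ ∃ h : V → ℝ, (∀ e, ∃ k : ℤ, h (G.tgt e) - h (G.src e) = k) ∧
      ∀ v, ((D₁ (.vertex v) - D₂ (.vertex v) : ℤ) : ℝ) = G.lap h v := by
  constructor
  · rintro ⟨φ, ⟨-, hφ⟩, hdiv⟩
    have haff : ∀ e, ∃ m : ℤ, ∀ t ∈ Icc (0 : ℝ) 1, onEdge φ e t = onEdge φ e 0 + m * t := by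
      refine fun e => (hφ e).eq_of_no_jump fun t ht => ?_
      have := hdiv (.inner e ⟨t, ht⟩)
      rw [Finsupp.sub_apply, h₁.apply_inner, h₂.apply_inner] at this
      simpa [incomingSlopes] using this.symm
    let h : V → ℝ := fun v => φ (.vertex v)
    have hdiff : ∀ e, ∀ m : ℤ, (∀ t ∈ Icc (0 : ℝ) 1, onEdge φ e t = onEdge φ e 0 + m * t) →
        h (G.tgt e) - h (G.src e) = m := by
      intro e m hm
      have := hm 1 (by simp)
      rw [G.onEdge_one, G.onEdge_zero] at this
      simp only [h, this]
      ring
    refine ⟨h, fun e => (haff e).imp fun m hm => hdiff e m hm, fun v => ?_⟩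
    rw [← Finsupp.sub_apply, hdiv, incomingSlopes_of_affine (h := h)]
    intro e t ht
    obtain ⟨m, hm⟩ := haff e
    rw [hdiff e m hm, hm t ht, G.onEdge_zero]
  · rintro ⟨h, hh, hdiv⟩
    refine ⟨G.interp h, isRational_interp hh, fun p => ?_⟩
    rw [incomingSlopes_of_affine (h := h) fun e t ht => G.onEdge_interp h e ht]
    cases p with
    | vertex v => rw [Finsupp.sub_apply, hdiv]
    | inner e t => rw [Finsupp.sub_apply, h₁.apply_inner, h₂.apply_inner]; simp

end LinEquiv

/-- If `D'` is equivalent to an integral divisor, the edges whose interior carries no chip of `D'`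
connect the graph, and no edge carries more than one chip in its interior, then `D'` is integral: a
function realizing the equivalence has integral differences between vertices, whereas a chip at an
interior point with coordinate `t` would make the difference along its edge congruent to `t`. -/
theorem LinEquiv.isIntegral [DecidableEq V] [Fintype E] {G : MultiGraph V E} {D' D : G.Div}
    (h : LinEquiv D' D) (hD : IsIntegral D)
    (hlink : G.Linked {e | ∀ t, D' (.inner e t) = 0} univ)
    (hone : ∀ e t, D' (.inner e t) ≠ 0 →
      D' (.inner e t) = 1 ∧ ∀ s, s ≠ t → D' (.inner e s) = 0) : IsIntegral D' := by
  obtain ⟨φ, ⟨-, hφ⟩, hdiv⟩ := h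
  have hjump : ∀ e (t : ℝ) (ht : t ∈ Ioo (0 : ℝ) 1),
      derivWithin (onEdge φ e) (Iic t) t - derivWithin (onEdge φ e) (Ici t) t =
        (D' (.inner e ⟨t, ht⟩) : ℝ) := by
    intro e t ht
    have := hdiv (.inner e ⟨t, ht⟩)
    rw [Finsupp.sub_apply, hD.apply_inner, sub_zero] at this
    rw [this, incomingSlopes]
  have hint : ∀ u v : V, ∃ k : ℤ, φ (.vertex v) - φ (.vertex u) = k := by
    intro u v
    by_contra hv
    obtain ⟨e, he, -, -, hcr⟩ := hlink {v | ∃ k : ℤ, φ (.vertex v) - φ (.vertex u) = k}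
      ⟨u, trivial, 0, by simp⟩ ⟨v, trivial, hv⟩
    obtain ⟨m, hm⟩ := (hφ e).eq_of_no_jump fun t ht => by rw [hjump e t ht, he]; simp
    have h1 := hm 1 (by simp)
    rw [G.onEdge_one, G.onEdge_zero] at h1
    refine hcr ⟨fun ⟨k, hk⟩ => ⟨k + m, ?_⟩, fun ⟨k, hk⟩ => ⟨k - m, ?_⟩⟩ <;> push_cast <;> linarith
  intro p hp
  cases p with
  | vertex v => exact ⟨v, rfl⟩
  | inner e τ =>
    exfalso
    obtain ⟨h1, h2⟩ := hone e τ (Finsupp.mem_support_iff.1 hp)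
    obtain ⟨m, hm⟩ := (hφ e).eq_of_jump (τ := τ) (c := 1) τ.2.1 fun t ht => by
      rw [hjump e t ht]
      split_ifs with htτ
      · subst htτ
        rw [h1]; simp
      · rw [h2 _ fun h => htτ (congrArg Subtype.val h)]; simp
    have h3 := hm 1 (by simp)
    obtain ⟨k, hk⟩ := hint (G.src e) (G.tgt e)
    rw [G.onEdge_one, G.onEdge_zero, max_eq_left (by linarith [τ.2.2])] at h3
    have h4 : (τ : ℝ) = (k - m + 1 : ℤ) := by push_cast; linarith
    have h5 := τ.2
    rw [h4] at h5
    have h6 : 0 < k - m + 1 := by exact_mod_cast h5.1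
    have h7 : k - m + 1 < 1 := by exact_mod_cast h5.2
    omega

end

section

variable (G : MultiGraph V E)

/-! ### Parametrized edges -/

/-- The unit speed parametrization of the closed edge `e`, extended to `ℝ` by constants. -/
noncomputable def edgeMap (e : E) (t : ℝ) : G.Point :=
  G.edgePath e (projIcc 0 1 zero_le_one t)

theorem continuous_edgeMap (e : E) : Continuous (G.edgeMap e) :=
  (G.continuous_edgePath e).comp continuous_projIcc

theorem edgeMap_zero (e : E) : G.edgeMap e 0 = .vertex (G.src e) := by
  rw [edgeMap, projIcc_of_mem _ (by simp), edgePath_zero]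

theorem edgeMap_one (e : E) : G.edgeMap e 1 = .vertex (G.tgt e) := by
  rw [edgeMap, projIcc_of_mem _ (by simp), edgePath_one]

theorem edgeMap_of_mem (e : E) {t : ℝ} (ht : t ∈ Ioo (0 : ℝ) 1) :
    G.edgeMap e t = .inner e ⟨t, ht⟩ := by
  rw [edgeMap, projIcc_of_mem _ (Ioo_subset_Icc_self ht), edgePath_of_mem_Ioo]

/-- The interior of the edge `e`. -/
def openEdge (e : E) : Set G.Point :=
  range (Point.inner e)

theorem isOpen_openEdge (e : E) : IsOpen (G.openEdge e) := by
  classical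
  have h : G.openEdge e = G.glue (fun _ => (0 : ℝ))
      (fun e' t => if e' = e then t * (1 - t) else 0) ⁻¹' {0}ᶜ := by
    ext p
    cases p with
    | vertex v => simp [openEdge, glue]
    | inner e' t =>
      have := t.2.1.ne'
      have := (sub_pos.2 t.2.2).ne'
      by_cases he : e' = e
      · subst he
        simp_all [openEdge, glue]
      · simp [openEdge, glue, he, Ne.symm he]
  rw [h]
  refine isOpen_compl_singleton.preimage (G.continuous_glue (by simp) (by simp) fun e' => ?_)
  by_cases he : e' = e <;> simp only [he, if_true, if_false] <;> fun_prop

theorem image_edgeMap_Ioo (e : E) : G.edgeMap e '' Ioo 0 1 = G.openEdge e := by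
  ext p
  constructor
  · rintro ⟨t, ht, rfl⟩
    exact ⟨⟨t, ht⟩, (G.edgeMap_of_mem e ht).symm⟩
  · rintro ⟨t, rfl⟩
    exact ⟨t, t.2, G.edgeMap_of_mem e t.2⟩

/-! ### Vertices of valency two -/

theorem valency_vertex [Fintype E] [DecidableEq V] (v : V) : G.valency (.vertex v) =
    ∑ e, ((if G.src e = v then 1 else 0) + if G.tgt e = v then 1 else 0) := by
  simp [valency, Finset.sum_add_distrib, Nat.card_eq_fintype_card, Fintype.card_subtype]

/-- The total valency of a set of vertices, summed over the edges. -/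
theorem sum_valency [Fintype E] [DecidableEq V] (B : Finset V) :
    ∑ v ∈ B, G.valency (.vertex v) =
      ∑ e, ((if G.src e ∈ B then 1 else 0) + if G.tgt e ∈ B then 1 else 0) := by
  simp only [valency_vertex]
  rw [Finset.sum_comm]
  refine Finset.sum_congr rfl fun e _ => ?_
  rw [Finset.sum_add_distrib, Finset.sum_ite_eq, Finset.sum_ite_eq]

theorem genus_eq_one [Fintype V] [Fintype E] (h : ∀ v, G.valency (.vertex v) = 2) :
    G.genus = 1 := by
  classical
  have h1 := G.sum_valency Finset.univ
  simp [h] at h1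
  simp only [genus]
  omega

/-- A set of vertices of valency two is not left by exactly one edge. -/
theorem false_of_unique_crossing [Fintype V] [Fintype E] {B : Set V}
    (hB : ∀ v ∈ B, G.valency (.vertex v) = 2) {e₀ : E} (h₀ : ¬(G.src e₀ ∈ B ↔ G.tgt e₀ ∈ B))
    (h : ∀ e, ¬(G.src e ∈ B ↔ G.tgt e ∈ B) → e = e₀) : False := by
  classical
  have h1 := G.sum_valency B.toFinset
  rw [Finset.sum_congr rfl fun v hv => hB v (mem_toFinset.1 hv)] at h1
  simp only [mem_toFinset, Finset.sum_const, smul_eq_mul] at h1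
  rw [← Finset.add_sum_erase _ _ (Finset.mem_univ e₀)] at h1
  have h2 : Even (∑ e ∈ Finset.univ.erase e₀,
      ((if G.src e ∈ B then 1 else 0) + if G.tgt e ∈ B then 1 else 0)) := by
    refine Finset.even_sum _ fun e he => ?_
    have h3 : G.src e ∈ B ↔ G.tgt e ∈ B := by
      by_contra hne
      exact (Finset.mem_erase.1 he).1 (h e hne)
    exact ⟨if G.tgt e ∈ B then 1 else 0, by simp only [h3]⟩
  have h4 : ((if G.src e₀ ∈ B then 1 else 0) + if G.tgt e₀ ∈ B then 1 else 0) = 1 := by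
    by_cases hs : G.src e₀ ∈ B <;> by_cases ht : G.tgt e₀ ∈ B <;> simp_all
  rw [h4] at h1
  obtain ⟨k, hk⟩ := h2
  omega

theorem IsOpenEdgeSegment.valency_eq {G : MultiGraph V E} {s : Set G.Point} (hs : G.IsOpenEdgeSegment s) {p : G.Point}
    (hp : p ∈ s) : G.valency p = 2 := by
  obtain ⟨-, -, c, ⟨x, -, rfl⟩, hsc⟩ := hs
  by_contra h
  exact connectedComponentIn_subset _ _ (hsc hp) h

/-! ### Segments with connected complement -/

/-- A connected set covered by pairwise disjoint open sets lies in each one that it meets. -/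
theorem _root_.IsPreconnected.subset_of_subset_iUnion {α ι : Type*} [TopologicalSpace α]
    {s : ι → Set α} (hs : ∀ i, IsOpen (s i)) (hd : ∀ i j, i ≠ j → Disjoint (s i) (s j))
    {K : Set α} (hK : IsPreconnected K) (hKs : K ⊆ ⋃ i, s i) {i : ι} {x : α} (hx : x ∈ K)
    (hxi : x ∈ s i) : K ⊆ s i := by
  refine IsPreconnected.subset_left_of_subset_union (hs i)
    (isOpen_biUnion fun j (_ : j ∈ {j | j ≠ i}) => hs j)
    (disjoint_iUnion₂_right.2 fun j hj => hd i j (Ne.symm hj)) ?_ ⟨x, hx, hxi⟩ hK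
  intro y hy
  obtain ⟨j, hj⟩ := mem_iUnion.1 (hKs hy)
  by_cases hji : j = i
  · exact Or.inl (hji ▸ hj)
  · exact Or.inr (mem_biUnion (show j ∈ {j | j ≠ i} from hji) hj)

/-- A function that separates the vertices in `Y` from the others, and that vanishes only at the
points with coordinates `q e` on the edges `e` in `F`. -/
noncomputable def sepFun (G : MultiGraph V E) (F : Set E) (q : E → ℝ) (Y : Set V) :
    G.Point → ℝ := by
  classical
  exact G.glue (fun v => if v ∈ Y then 1 else -1) fun e t =>
    if e ∈ F then (if G.src e ∈ Y then 1 else -1) * max 0 (1 - t / q e) +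
      (if G.tgt e ∈ Y then 1 else -1) * max 0 ((t - q e) / (1 - q e))
    else if G.src e ∈ Y then 1 else -1

theorem continuous_sepFun {G : MultiGraph V E} {F : Set E} {q : E → ℝ} (hq : ∀ e ∈ F, q e ∈ Ioo (0 : ℝ) 1) {Y : Set V}
    (hY : ∀ e ∉ F, (G.src e ∈ Y ↔ G.tgt e ∈ Y)) : Continuous (G.sepFun F q Y) := by
  unfold sepFun
  refine G.continuous_glue ?_ ?_ ?_ <;> intro e <;> by_cases he : e ∈ F <;>
    simp only [he, if_true, if_false]
  · have := hq e he
    rw [max_eq_left (a := (0 : ℝ)) (b := (0 - q e) / (1 - q e))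
      (div_nonpos_of_nonpos_of_nonneg (by linarith [this.1]) (by linarith [this.2]))]
    simp
  · have := hq e he
    rw [max_eq_left (a := (0 : ℝ)) (b := 1 - 1 / q e)
      (sub_nonpos.2 ((one_le_div this.1).2 this.2.le)), div_self (by linarith [this.2])]
    simp
  · have h := hY e he
    by_cases hs : G.src e ∈ Y
    · rw [if_pos hs, if_pos (h.1 hs)]
    · rw [if_neg hs, if_neg (mt h.2 hs)]
  · fun_prop
  · fun_prop

theorem sepFun_compl (F : Set E) (q : E → ℝ) (Y : Set V) (p : G.Point) :
    G.sepFun F q Yᶜ p = -G.sepFun F q Y p := by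
  unfold sepFun
  cases p with
  | vertex v => by_cases h : v ∈ Y <;> simp [glue, h]
  | inner e t =>
    by_cases h : G.src e ∈ Y <;> by_cases h' : G.tgt e ∈ Y <;> by_cases he : e ∈ F <;>
      simp [glue, h, h', he] <;> ring

theorem eq_of_sepFun_eq_zero {G : MultiGraph V E} {F : Set E} {q : E → ℝ} (hq : ∀ e ∈ F, q e ∈ Ioo (0 : ℝ) 1)
    {Y : Set V} {p : G.Point} (hp : G.sepFun F q Y p = 0) :
    ∃ e ∈ F, p = G.edgeMap e (q e) := by
  unfold sepFun at hp
  cases p with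
  | vertex v => by_cases h : v ∈ Y <;> simp [glue, h] at hp
  | inner e t =>
    by_cases he : e ∈ F
    · have h1 := hq e he
      refine ⟨e, he, ?_⟩
      rw [G.edgeMap_of_mem e h1]
      congr 1
      ext
      simp only [glue, he, if_true] at hp
      by_contra hne
      rcases lt_or_gt_of_ne hne with hlt | hlt
      · have h2 : (t : ℝ) / q e < 1 := (div_lt_one h1.1).2 hlt
        rw [max_eq_left (a := (0 : ℝ)) (b := (t - q e) / (1 - q e))
          (div_nonpos_of_nonpos_of_nonneg (by linarith) (by linarith [h1.2])),
          max_eq_right (by linarith)] at hp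
        split_ifs at hp <;> linarith
      · have h2 : 1 < (t : ℝ) / q e := (one_lt_div h1.1).2 hlt
        have h3 : 0 < (t - q e) / (1 - q e) := div_pos (by linarith) (by linarith [h1.2])
        rw [max_eq_right (a := (0 : ℝ)) (b := (t - q e) / (1 - q e)) h3.le,
          max_eq_left (by linarith)] at hp
        split_ifs at hp <;> linarith
    · by_cases h : G.src e ∈ Y <;> simp [glue, h, he] at hp

section Segments

variable [Fintype V] [Fintype E] {G}

/-- Distinct segments of a family with connected complement do not meet the interior of the same
edge. -/
theorem eq_of_meets_same_edge {s : Fin G.genus → Set G.Point}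
    (hs : ∀ i, G.IsOpenEdgeSegment (s i)) (hd : ∀ i j, i ≠ j → Disjoint (s i) (s j))
    (hX : IsPreconnected (⋃ i, s i)ᶜ) {i j : Fin G.genus} {e : E} {a b : Ioo (0 : ℝ) 1}
    (ha : .inner e a ∈ s i) (hb : .inner e b ∈ s j) : i = j := by
  classical
  by_contra hij
  wlog hab : a < b generalizing i j a b
  · rcases lt_or_eq_of_le (not_lt.1 hab) with h | h
    · exact this hb ha (Ne.symm hij) h
    · exact (hd i j hij).le_bot ⟨ha, h ▸ hb⟩
  have hab' : (a : ℝ) < b := hab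
  have ha0 := a.2.1
  have hb1 := b.2.2
  -- the complement contains a point between the two segments
  obtain ⟨k, hk, hkX⟩ : ∃ k ∈ Icc (a : ℝ) b, G.edgeMap e k ∈ (⋃ i, s i)ᶜ := by
    by_contra! hno
    have hKs : G.edgeMap e '' Icc a b ⊆ s i :=
      IsPreconnected.subset_of_subset_iUnion (fun i => (hs i).1) hd
        (isPreconnected_Icc.image _ (G.continuous_edgeMap e).continuousOn)
        (by rintro _ ⟨t, ht, rfl⟩; exact not_not.1 (hno t ht))
        ⟨a, ⟨le_rfl, hab'.le⟩, G.edgeMap_of_mem e a.2⟩ ha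
    exact (hd i j hij).le_bot ⟨hKs ⟨b, ⟨hab'.le, le_rfl⟩, G.edgeMap_of_mem e b.2⟩, hb⟩
  -- hence the complement lies entirely between them, and all vertices lie on the segments
  let f : E → ℝ → ℝ := fun e' t => if e' = e then max ((a - t) / a) ((t - b) / (1 - b)) else 1
  have hb1' : (1 : ℝ) - b ≠ 0 := by linarith
  have h0 : ∀ e', f e' 0 = 1 := by
    intro e'
    have : ((0 : ℝ) - b) / (1 - b) ≤ 1 := by
      rw [div_le_one (by linarith)]; linarith
    by_cases he : e' = e
    · simp only [f, if_pos he, sub_zero, div_self ha0.ne', max_eq_left this]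
    · simp only [f, if_neg he]
  have h1 : ∀ e', f e' 1 = 1 := by
    intro e'
    have : ((a : ℝ) - 1) / a ≤ 1 := by
      rw [div_le_one ha0]; linarith
    by_cases he : e' = e
    · simp only [f, if_pos he, div_self hb1', max_eq_right this]
    · simp only [f, if_neg he]
  have hcont : Continuous (G.glue (fun _ => (1 : ℝ)) f) := by
    refine G.continuous_glue h0 h1 fun e' => ?_
    by_cases he : e' = e <;> simp only [f, he, if_true, if_false] <;> fun_prop
  have hne : ∀ p ∈ (⋃ i, s i)ᶜ, G.glue (fun _ => (1 : ℝ)) f p ≠ 0 := by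
    intro p hp h
    cases p with
    | vertex v => simp [glue] at h
    | inner e' t =>
      by_cases he : e' = e
      · subst he
        simp only [glue, f, if_true] at h
        rcases max_choice (((a : ℝ) - t) / a) ((t - b) / (1 - b)) with h' | h' <;> rw [h'] at h
        · rw [div_eq_zero_iff, or_iff_left ha0.ne', sub_eq_zero] at h
          rw [← Subtype.ext h] at hp
          exact hp (mem_iUnion.2 ⟨i, ha⟩)
        · rw [div_eq_zero_iff, or_iff_left hb1', sub_eq_zero] at h
          rw [Subtype.ext h] at hp
          exact hp (mem_iUnion.2 ⟨j, hb⟩)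
      · simp [glue, f, he] at h
  have hkIoo : k ∈ Ioo (0 : ℝ) 1 := ⟨ha0.trans_le hk.1, hk.2.trans_lt hb1⟩
  rw [G.edgeMap_of_mem e hkIoo] at hkX
  have hkneg : G.glue (fun _ => (1 : ℝ)) f (.inner e ⟨k, hkIoo⟩) ≤ 0 := by
    simp only [glue, f, if_true]
    exact max_le (div_nonpos_of_nonpos_of_nonneg (by linarith [hk.1]) ha0.le)
      (div_nonpos_of_nonpos_of_nonneg (by linarith [hk.2]) (by linarith))
  have hcov : ∀ v, ∃ i, .vertex v ∈ s i := by
    intro v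
    by_contra hv
    obtain ⟨p, hp, hp0⟩ := hX.intermediate_value hkX (b := .vertex v)
      (fun h => hv (mem_iUnion.1 h)) hcont.continuousOn ⟨hkneg, zero_le_one⟩
    exact hne p hp hp0
  have hg := G.genus_eq_one fun v => by
    obtain ⟨i, hi⟩ := hcov v
    exact (hs i).valency_eq hi
  have := i.2
  have := j.2
  exact hij (Fin.ext (by omega))

/-- Let each edge of `F` have an interior point on a segment of its own. If the complement of the
segments is connected, then so is the graph without the edges of `F`. -/
theorem linked_of_isPreconnected {ι : Type*} (hG : G.Linked univ univ) {s : ι → Set G.Point}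
    (hs : ∀ i, G.IsOpenEdgeSegment (s i)) (hd : ∀ i j, i ≠ j → Disjoint (s i) (s j))
    (hX : IsPreconnected (⋃ i, s i)ᶜ) {F : Set E} {q : E → ℝ}
    (hq : ∀ e ∈ F, q e ∈ Ioo (0 : ℝ) 1) {σ : E → ι}
    (hqσ : ∀ e ∈ F, G.edgeMap e (q e) ∈ s (σ e)) (hσ : InjOn σ F) :
    G.Linked {e | e ∉ F} univ := by
  -- no side of a cut in `F` is covered by the segments
  have claim : ∀ Y : Set V, Y.Nonempty → Y ≠ univ → (∀ e ∉ F, (G.src e ∈ Y ↔ G.tgt e ∈ Y)) →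
      (∀ p, 0 < G.sepFun F q Y p → p ∈ ⋃ i, s i) → False := by
    rintro Y ⟨a, ha⟩ hYne hY hpos
    obtain ⟨b, hb⟩ := (ne_univ_iff_exists_notMem Y).1 hYne
    obtain ⟨i₀, hi₀⟩ := mem_iUnion.1 (hpos (.vertex a) (by simp [sepFun, glue, ha]))
    let B : Set V := {v | v ∈ Y ∧ .vertex v ∈ s i₀}
    have hpath : ∀ (e : E) (x y : ℝ), (∀ t ∈ Icc x y, G.edgeMap e t ∈ ⋃ i, s i) →
        ∀ t₀ ∈ Icc x y, G.edgeMap e t₀ ∈ s i₀ → ∀ t ∈ Icc x y, G.edgeMap e t ∈ s i₀ :=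
      fun e x y hcov t₀ ht₀ hmem t ht =>
        IsPreconnected.subset_of_subset_iUnion (fun i => (hs i).1) hd
          ((isPreconnected_Icc (a := x) (b := y)).image _ (G.continuous_edgeMap e).continuousOn)
          (by rintro _ ⟨t, ht, rfl⟩; exact hcov t ht) ⟨t₀, ht₀, rfl⟩ hmem ⟨t, ht, rfl⟩
    have hvert : ∀ v ∈ Y, .vertex v ∈ ⋃ i, s i := fun v hv =>
      hpos _ (by simp [sepFun, glue, hv])
    have hcross : ∀ e, ¬(G.src e ∈ B ↔ G.tgt e ∈ B) → e ∈ F ∧ σ e = i₀ := by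
      intro e he
      by_cases heF : e ∈ F
      · refine ⟨heF, ?_⟩
        have h1 := hq e heF
        have hmem : G.edgeMap e (q e) ∈ s i₀ := by
          by_cases hsB : G.src e ∈ B
          · refine hpath e 0 (q e) (fun t ht => ?_) 0 ⟨le_rfl, h1.1.le⟩
              (by rw [edgeMap_zero]; exact hsB.2) _ ⟨h1.1.le, le_rfl⟩
            rcases eq_or_lt_of_le ht.1 with rfl | ht0
            · rw [edgeMap_zero]; exact hvert _ hsB.1
            rcases eq_or_lt_of_le ht.2 with rfl | htq
            · exact mem_iUnion.2 ⟨_, hqσ e heF⟩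
            rw [G.edgeMap_of_mem e ⟨ht0, htq.trans h1.2⟩]
            refine hpos _ ?_
            have h2 : t / q e < 1 := (div_lt_one h1.1).2 htq
            simp only [sepFun, glue, heF, hsB.1, if_true]
            rw [max_eq_left (a := (0 : ℝ)) (b := (t - q e) / (1 - q e))
              (div_nonpos_of_nonpos_of_nonneg (by linarith) (by linarith [h1.2])),
              max_eq_right (by linarith)]
            linarith
          · have htB : G.tgt e ∈ B := by tauto
            refine hpath e (q e) 1 (fun t ht => ?_) 1 ⟨h1.2.le, le_rfl⟩
              (by rw [edgeMap_one]; exact htB.2) _ ⟨le_rfl, h1.2.le⟩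
            rcases eq_or_lt_of_le ht.2 with rfl | ht1
            · rw [edgeMap_one]; exact hvert _ htB.1
            rcases eq_or_lt_of_le ht.1 with rfl | htq
            · exact mem_iUnion.2 ⟨_, hqσ e heF⟩
            rw [G.edgeMap_of_mem e ⟨h1.1.trans htq, ht1⟩]
            refine hpos _ ?_
            have h2 : 1 < t / q e := (one_lt_div h1.1).2 htq
            have h3 : 0 < (t - q e) / (1 - q e) := div_pos (by linarith) (by linarith [h1.2])
            simp only [sepFun, glue, heF, htB.1, if_true]
            rw [max_eq_right (a := (0 : ℝ)) (b := (t - q e) / (1 - q e)) h3.le,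
              max_eq_left (by linarith)]
            linarith
        by_contra hne
        exact (hd _ _ hne).le_bot ⟨hqσ e heF, hmem⟩
      · exfalso
        have hY' := hY e heF
        have hcov : G.src e ∈ Y → ∀ t ∈ Icc (0 : ℝ) 1, G.edgeMap e t ∈ ⋃ i, s i := by
          intro hsY t ht
          rcases eq_or_lt_of_le ht.1 with rfl | ht0
          · rw [edgeMap_zero]; exact hvert _ hsY
          rcases eq_or_lt_of_le ht.2 with rfl | ht1
          · rw [edgeMap_one]; exact hvert _ (hY'.1 hsY)
          rw [G.edgeMap_of_mem e ⟨ht0, ht1⟩]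
          exact hpos _ (by simp [sepFun, glue, heF, hsY])
        refine he ⟨fun h => ⟨hY'.1 h.1, ?_⟩, fun h => ⟨hY'.2 h.1, ?_⟩⟩
        · rw [← edgeMap_one]
          exact hpath e 0 1 (hcov h.1) 0 (by simp) (by rw [edgeMap_zero]; exact h.2) 1 (by simp)
        · rw [← edgeMap_zero]
          exact hpath e 0 1 (hcov (hY'.2 h.1)) 1 (by simp) (by rw [edgeMap_one]; exact h.2) 0
            (by simp)
    obtain ⟨e₀, -, -, -, h₀⟩ := hG B ⟨a, trivial, ha, hi₀⟩ ⟨b, trivial, fun h => hb h.1⟩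
    refine G.false_of_unique_crossing (B := B) (fun v hv => (hs i₀).valency_eq hv.2) h₀
      fun e he => ?_
    obtain ⟨h1, h2⟩ := hcross e he
    obtain ⟨h3, h4⟩ := hcross e₀ h₀
    exact hσ h1 h3 (h2.trans h4.symm)
  rintro Y ⟨a, -, ha⟩ ⟨b, -, hb⟩
  by_contra! hno
  have hY : ∀ e ∉ F, (G.src e ∈ Y ↔ G.tgt e ∈ Y) := fun e he => hno e he trivial trivial
  have hcont := continuous_sepFun hq hY
  by_cases hside : ∀ p, 0 < G.sepFun F q Y p → p ∈ ⋃ i, s i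
  · exact claim Y ⟨a, ha⟩ (fun h => hb (h ▸ mem_univ b)) hY hside
  push Not at hside
  obtain ⟨p, hp, hpX⟩ := hside
  refine claim Yᶜ ⟨b, hb⟩ (fun h => (h ▸ mem_univ a : a ∈ Yᶜ) ha) (fun e he => not_congr (hY e he))
    fun p' hp' => ?_
  rw [sepFun_compl] at hp'
  by_contra hp'X
  obtain ⟨x, hx, hx0⟩ := hX.intermediate_value hp'X hpX hcont.continuousOn
    ⟨(neg_pos.1 hp').le, hp.le⟩
  obtain ⟨e, he, rfl⟩ := eq_of_sepFun_eq_zero hq hx0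
  exact hx (mem_iUnion.2 ⟨_, hqσ e he⟩)

/-- The interior of an edge carries at most one chip of a break divisor, and the edges without
chips in their interior connect the graph. -/
theorem IsBreak.inner_chips (hG : G.Linked univ univ) {B : G.Div} (hB : IsBreak B) :
    G.Linked {e | ∀ t, B (.inner e t) = 0} univ ∧
      ∀ e t, B (.inner e t) ≠ 0 → B (.inner e t) = 1 ∧ ∀ s, s ≠ t → B (.inner e s) = 0 := by
  classical
  obtain ⟨s, p, hs, hd, hp, rfl, hcontr⟩ := hB
  have hX : IsPreconnected (⋃ i, s i)ᶜ :=
    isPreconnected_iff_preconnectedSpace.2 inferInstance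
  have hval : ∀ x : G.Point, (∑ i, Finsupp.single (p i) (1 : ℤ) : G.Div) x =
      ∑ i, if p i = x then 1 else 0 := by
    intro x
    rw [Finsupp.finsetSum_apply]
    simp only [Finsupp.single_apply]
  have hmeet : ∀ i e t, p i = .inner e t → ∃ t', .inner e t' ∈ s i := by
    intro i e t hi
    obtain ⟨_, ⟨t', rfl⟩, ht'⟩ := mem_closure_iff.1 (hp i) (G.openEdge e) (G.isOpen_openEdge e)
      ⟨t, hi.symm⟩
    exact ⟨t', ht'⟩
  have huniq : ∀ i j e t t', p i = .inner e t → p j = .inner e t' → i = j := by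
    intro i j e t t' hi hj
    obtain ⟨a, ha⟩ := hmeet i e t hi
    obtain ⟨b, hb⟩ := hmeet j e t' hj
    exact eq_of_meets_same_edge hs hd hX ha hb
  have hex : ∀ e t, (∑ i, Finsupp.single (p i) (1 : ℤ) : G.Div) (.inner e t) ≠ 0 →
      ∃ i, p i = .inner e t := by
    intro e t h
    rw [hval] at h
    obtain ⟨i, -, hi⟩ := Finset.exists_ne_zero_of_sum_ne_zero h
    exact ⟨i, by by_contra hne; exact hi (if_neg hne)⟩
  constructor
  · let F : Set E := {e | ∃ i t, p i = .inner e t}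
    have hF : ∀ e ∈ F, ∃ i, (∃ t, p i = .inner e t) ∧
        ∃ q ∈ Ioo (0 : ℝ) 1, G.edgeMap e q ∈ s i := by
      rintro e ⟨i, t, hi⟩
      obtain ⟨t', ht'⟩ := hmeet i e t hi
      exact ⟨i, ⟨t, hi⟩, t', t'.2, by rwa [G.edgeMap_of_mem e t'.2]⟩
    by_cases hne : Nonempty (Fin G.genus)
    · obtain ⟨i₀⟩ := hne
      have hF' : ∀ e, ∃ (i : Fin G.genus) (q : ℝ), e ∈ F →
          (∃ t, p i = .inner e t) ∧ q ∈ Ioo (0 : ℝ) 1 ∧ G.edgeMap e q ∈ s i := by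
        intro e
        by_cases he : e ∈ F
        · obtain ⟨i, h1, q, h2, h3⟩ := hF e he
          exact ⟨i, q, fun _ => ⟨h1, h2, h3⟩⟩
        · exact ⟨i₀, 0, fun h => absurd h he⟩
      choose σ q h using hF'
      refine (linked_of_isPreconnected hG hs hd hX (F := F) (q := q) (fun e he => (h e he).2.1)
        (σ := σ) (fun e he => (h e he).2.2) ?_).mono ?_
      · intro e he e' he' hee'
        obtain ⟨t, ht⟩ := (h e he).1
        obtain ⟨t', ht'⟩ := (h e' he').1
        rw [hee', ht'] at ht
        cases ht
        rfl
      · intro e he _ _ t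
        by_contra hne
        obtain ⟨i, hi⟩ := hex e t hne
        exact he ⟨i, t, hi⟩
    · refine hG.mono fun e _ _ _ t => ?_
      by_contra hne'
      obtain ⟨i, -⟩ := hex e t hne'
      exact hne ⟨i⟩
  · intro e t h
    obtain ⟨i, hi⟩ := hex e t h
    constructor
    · rw [hval, Finset.sum_eq_single i (fun j _ hji => if_neg fun hj =>
        hji (huniq j i e t t hj hi)) (by simp), if_pos hi]
    · intro t' ht'
      by_contra hne
      obtain ⟨j, hj⟩ := hex e t' hne
      have := huniq i j e t t' hi hj
      subst this
      rw [hi] at hj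
      cases hj
      exact ht' rfl

theorem IsSemibreak.inner_chips (hG : G.Linked univ univ) {D : G.Div} (hD : IsSemibreak D) :
    G.Linked {e | ∀ t, D (.inner e t) = 0} univ ∧
      ∀ e t, D (.inner e t) ≠ 0 → D (.inner e t) = 1 ∧ ∀ s, s ≠ t → D (.inner e s) = 0 := by
  obtain ⟨h0, B, hB, hle⟩ := hD
  obtain ⟨h1, h2⟩ := hB.inner_chips hG
  have hz : ∀ p, B p = 0 → D p = 0 := fun p hp => le_antisymm (hp ▸ hle p) (h0 p)
  refine ⟨h1.mono fun e he _ _ t => hz _ (he t), fun e t ht => ?_⟩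
  obtain ⟨h3, h4⟩ := h2 e t fun h => ht (hz _ h)
  refine ⟨?_, fun s hs => hz _ (h4 s hs)⟩
  have h5 := hle (.inner e t)
  have h6 := h0 (.inner e t)
  simp only [Finsupp.coe_zero, Pi.zero_apply] at h6
  omega

end Segments

end

/-! ### Trees are contractible -/

instance [Finite V] [Finite E] (G : MultiGraph V E) : CompactSpace G.Point := by
  have h : (univ : Set G.Point) = range Point.vertex ∪ ⋃ e, range (G.edgePath e) := by
    refine (eq_univ_of_forall fun p => ?_).symm
    cases p with
    | vertex v => exact Or.inl ⟨v, rfl⟩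
    | inner e t => exact Or.inr (mem_iUnion.2 ⟨e, _, G.edgePath_inner e t⟩)
  refine ⟨h ▸ (finite_range _).isCompact.union (isCompact_iUnion fun e => ?_)⟩
  exact isCompact_range (G.continuous_edgePath e)

namespace RootedTree

variable [DecidableEq V] {G : MultiGraph V E} (T : G.RootedTree)

/-- The subspace of the metric graph formed by the tree: all vertices and all tree edges. -/
def carrier : Set G.Point :=
  {p | ∀ e t, p = .inner e t → e ∈ range T.edge}

theorem vertex_mem_carrier (v : V) : .vertex v ∈ T.carrier := by
  intro e t h
  cases h

theorem inner_mem_carrier {e : E} {t : Ioo (0 : ℝ) 1} :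
    .inner e t ∈ T.carrier ↔ e ∈ range T.edge := by
  constructor
  · exact fun h => h e t rfl
  · rintro h _ _ ⟨⟩
    exact h

theorem carrier_eq : T.carrier = (⋃ e ∈ (range T.edge)ᶜ, G.openEdge e)ᶜ := by
  ext p
  cases p with
  | vertex v => simp [vertex_mem_carrier, openEdge]
  | inner e t =>
    rw [inner_mem_carrier]
    simp only [openEdge, mem_compl_iff, mem_iUnion, mem_range, not_exists]
    constructor
    · rintro ⟨v, rfl⟩ e' he' t' h
      cases h
      exact he' v rfl
    · intro h
      by_contra! hno
      exact h e hno t rfl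

theorem isClosed_carrier : IsClosed T.carrier := by
  rw [carrier_eq]
  exact (isOpen_biUnion fun e _ => G.isOpen_openEdge e).isClosed_compl

/-- Coordinates on the tree: `T.coord p v` is the portion of the edge from `par v` to `v` that is
covered by the path from the root to `p`. (Off the tree these functions are extended affinely.) -/
def coord (p : G.Point) (v : V) : ℝ :=
  G.interp (fun u => if v ∈ T.anc u then 1 else 0) p

theorem continuous_coord : Continuous T.coord :=
  continuous_pi fun _ => G.continuous_interp _

theorem coord_vertex (u v : V) : T.coord (.vertex u) v = if v ∈ T.anc u then 1 else 0 :=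
  rfl

theorem coord_inner (e : E) (t : Ioo (0 : ℝ) 1) (v : V) :
    T.coord (.inner e t) v = (if v ∈ T.anc (G.src e) then 1 else 0) +
      ((if v ∈ T.anc (G.tgt e) then 1 else 0) - if v ∈ T.anc (G.src e) then 1 else 0) * t :=
  rfl

/-- The coordinates of the point at distance `τ` from `par v` on the edge from `par v` to `v`. -/
def branch (v : V) (τ : ℝ) (w : V) : ℝ :=
  if w = v then τ else if w ∈ T.anc (T.par v) then 1 else 0

theorem branch_one {v : V} (hv : v ≠ T.root) : T.branch v 1 = T.coord (.vertex v) := by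
  ext w
  rw [branch, coord_vertex, T.anc_eq v hv]
  by_cases h : w = v <;> simp [h]

theorem branch_zero {v : V} (hv : v ≠ T.root) :
    T.branch v 0 = T.coord (.vertex (T.par v)) := by
  ext w
  rw [branch, coord_vertex]
  by_cases h : w = v
  · subst h
    simp [T.notMem_anc_par w hv]
  · simp [h]

theorem coord_edge {v : V} (hv : v ≠ T.root) :
    (∀ t, T.coord (.inner (T.edge ⟨v, hv⟩) t) = T.branch v t) ∨
      ∀ t, T.coord (.inner (T.edge ⟨v, hv⟩) t) = T.branch v (1 - t) := by
  have h1 := T.anc_eq v hv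
  have h2 := T.notMem_anc_par v hv
  rcases T.ends ⟨v, hv⟩ with ⟨h, h'⟩ | ⟨h, h'⟩
  · refine Or.inl fun t => ?_
    ext w
    rw [branch, coord_inner, h, h', h1]
    by_cases hw : w = v
    · subst hw; simp [h2]
    · simp [hw]
  · refine Or.inr fun t => ?_
    ext w
    rw [branch, coord_inner, h, h', h1]
    by_cases hw : w = v
    · subst hw; simp [h2]; ring
    · simp [hw]

theorem exists_coord_edge {v : V} (hv : v ≠ T.root) {t : ℝ} (ht : t ∈ Ioo (0 : ℝ) 1) :
    ∃ τ ∈ Ioo (0 : ℝ) 1,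
      T.coord (.inner (T.edge ⟨v, hv⟩) ⟨t, ht⟩) = T.branch v τ := by
  rcases T.coord_edge hv with h | h
  · exact ⟨t, ht, h _⟩
  · exact ⟨1 - t, ⟨by linarith [ht.2], by linarith [ht.1]⟩, h _⟩

theorem branch_mem_image {v : V} (hv : v ≠ T.root) {τ : ℝ} (hτ : τ ∈ Icc (0 : ℝ) 1) :
    T.branch v τ ∈ T.coord '' T.carrier := by
  rcases eq_or_lt_of_le hτ.1 with rfl | h0
  · exact ⟨_, T.vertex_mem_carrier _, (T.branch_zero hv).symm⟩
  rcases eq_or_lt_of_le hτ.2 with rfl | h1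
  · exact ⟨_, T.vertex_mem_carrier _, (T.branch_one hv).symm⟩
  have hmem : ∀ t, Point.inner (T.edge ⟨v, hv⟩) t ∈ T.carrier := fun t =>
    T.inner_mem_carrier.2 ⟨_, rfl⟩
  rcases T.coord_edge hv with h | h
  · exact ⟨_, hmem ⟨τ, h0, h1⟩, h _⟩
  · exact ⟨_, hmem ⟨1 - τ, by linarith, by linarith⟩, by rw [h, sub_sub_cancel]⟩

theorem injOn_coord : InjOn T.coord T.carrier := by
  have hne : ∀ (u v : V) {τ : ℝ}, τ ∈ Ioo (0 : ℝ) 1 → T.coord (.vertex u) ≠ T.branch v τ := by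
    intro u v τ hτ h
    have := congrFun h v
    rw [coord_vertex, branch, if_pos rfl] at this
    split_ifs at this
    · exact hτ.2.ne this.symm
    · exact hτ.1.ne this
  intro p hp p' hp' h
  cases p with
  | vertex u =>
    cases p' with
    | vertex u' =>
      congr 1
      refine T.anc_injective (Finset.ext fun w => ?_)
      have := congrFun h w
      rw [coord_vertex, coord_vertex] at this
      by_cases h1 : w ∈ T.anc u <;> by_cases h2 : w ∈ T.anc u' <;> simp_all
    | inner e t =>
      obtain ⟨v, rfl⟩ := T.inner_mem_carrier.1 hp'
      obtain ⟨τ, hτ, h'⟩ := T.exists_coord_edge v.2 t.2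
      exact absurd (h.trans h') (hne _ _ hτ)
  | inner e t =>
    obtain ⟨v, rfl⟩ := T.inner_mem_carrier.1 hp
    obtain ⟨τ, hτ, h1⟩ := T.exists_coord_edge v.2 t.2
    cases p' with
    | vertex u => exact absurd (h.symm.trans h1) (hne _ _ hτ)
    | inner e' t' =>
      obtain ⟨v', rfl⟩ := T.inner_mem_carrier.1 hp'
      obtain ⟨τ', hτ', h1'⟩ := T.exists_coord_edge v'.2 t'.2
      have hvv : v = v' := by
        by_contra hvv
        have h2 := congrFun (h1.symm.trans (h.trans h1')) v
        rw [branch, branch, if_pos rfl, if_neg fun h => hvv (Subtype.ext h)] at h2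
        split_ifs at h2
        · exact hτ.2.ne h2
        · exact hτ.1.ne' h2
      subst hvv
      congr 1
      have h2 := congrFun h v
      have h3 := T.self_mem_anc v.2
      have h4 := T.notMem_anc_par _ v.2
      rw [coord_inner, coord_inner] at h2
      ext
      rcases T.ends v with ⟨h, h'⟩ | ⟨h, h'⟩ <;> rw [h, h'] at h2 <;>
        simp only [h3, h4, if_true, if_false] at h2 <;> linarith

/-- The retraction of the tree, in coordinates, onto the points at distance at most `s` from the
root. -/
def truncate (s : ℝ) (a : V → ℝ) (w : V) : ℝ :=
  min (a w) (max 0 (s - (T.anc w).card + 1))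

theorem truncate_branch_mem {v : V} (hv : v ≠ T.root) {τ : ℝ} (hτ : τ ∈ Icc (0 : ℝ) 1) {s : ℝ}
    (ih : T.truncate s (T.coord (.vertex (T.par v))) ∈ T.coord '' T.carrier) :
    T.truncate s (T.branch v τ) ∈ T.coord '' T.carrier := by
  by_cases hs : (T.anc v).card - 1 ≤ s
  · -- all ancestors of `v` are within distance `s`, only the last edge is cut
    have h : T.truncate s (T.branch v τ) =
        T.branch v (min τ (max 0 (s - (T.anc v).card + 1))) := by
      ext w
      unfold truncate branch
      by_cases hw : w = v
      · simp [hw]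
      · simp only [if_neg hw]
        split_ifs with hw'
        · have h1 := Finset.card_le_card (T.anc_subset hw')
          have h2 := T.card_anc hv
          have h3 : ((T.anc w).card : ℝ) + 1 ≤ (T.anc v).card := by
            rw [h2]; exact_mod_cast Nat.succ_le_succ h1
          exact min_eq_left (le_max_of_le_right (by linarith))
        · exact min_eq_left (le_max_left _ _)
    rw [h]
    exact T.branch_mem_image hv ⟨le_min hτ.1 (le_max_left _ _), (min_le_left _ _).trans hτ.2⟩
  · -- the last edge is beyond distance `s`
    have h : T.truncate s (T.branch v τ) = T.truncate s (T.coord (.vertex (T.par v))) := by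
      ext w
      rw [← T.branch_zero hv]
      unfold truncate branch
      by_cases hw : w = v
      · subst hw
        rw [max_eq_left (by linarith)]
        simp [hτ.1]
      · simp [hw]
    rwa [h]

theorem coord_root : T.coord (.vertex T.root) = 0 := by
  ext w
  simp [coord_vertex, T.anc_root]

theorem truncate_mem {s : ℝ} {a : V → ℝ} (ha : a ∈ T.coord '' T.carrier) :
    T.truncate s a ∈ T.coord '' T.carrier := by
  have hvert : ∀ v, T.truncate s (T.coord (.vertex v)) ∈ T.coord '' T.carrier := by
    intro v
    induction v using T.par_induction with
    | h0 =>
      refine ⟨_, T.vertex_mem_carrier T.root, ?_⟩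
      ext w
      simp [truncate, coord_root]
    | h1 v hv ih =>
      rw [← T.branch_one hv]
      exact T.truncate_branch_mem hv (by simp) ih
  obtain ⟨p, hp, rfl⟩ := ha
  cases p with
  | vertex v => exact hvert v
  | inner e t =>
    obtain ⟨v, rfl⟩ := T.inner_mem_carrier.1 hp
    obtain ⟨τ, hτ, h⟩ := T.exists_coord_edge v.2 t.2
    rw [h]
    exact T.truncate_branch_mem v.2 (Ioo_subset_Icc_self hτ) (hvert _)

theorem coord_nonneg_le_one {p : G.Point} (hp : p ∈ T.carrier) (w : V) :
    0 ≤ T.coord p w ∧ T.coord p w ≤ 1 := by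
  cases p with
  | vertex v => rw [coord_vertex]; split_ifs <;> simp
  | inner e t =>
    obtain ⟨v, rfl⟩ := T.inner_mem_carrier.1 hp
    obtain ⟨τ, hτ, h⟩ := T.exists_coord_edge v.2 t.2
    rw [h, branch]
    split_ifs
    · exact ⟨hτ.1.le, hτ.2.le⟩
    · simp
    · simp

theorem contractibleSpace_image_coord [Fintype V] :
    ContractibleSpace ↥(T.coord '' T.carrier) := by
  let N : ℝ := Fintype.card V
  have hcont : Continuous fun x : unitInterval × ↥(T.coord '' T.carrier) =>
      T.truncate (N * (1 - x.1)) x.2 := by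
    refine continuous_pi fun w => ?_
    unfold truncate
    have : Continuous fun x : unitInterval × ↥(T.coord '' T.carrier) => (x.2 : V → ℝ) w :=
      (continuous_apply w).comp (continuous_subtype_val.comp continuous_snd)
    fun_prop
  let c : ↥(T.coord '' T.carrier) := ⟨_, _, T.vertex_mem_carrier T.root, rfl⟩
  rw [contractible_iff_id_nullhomotopic]
  refine ⟨c, ⟨⟨⟨fun x => ⟨_, T.truncate_mem (s := N * (1 - x.1)) x.2.2⟩,
    hcont.subtype_mk _⟩, ?_, ?_⟩⟩⟩
  · rintro ⟨_, p, hp, rfl⟩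
    refine Subtype.ext (funext fun w => ?_)
    have h1 : ((T.anc w).card : ℝ) ≤ N := Nat.cast_le.2 (Finset.card_le_univ _)
    simp only [truncate, Icc.coe_zero, sub_zero, mul_one, ContinuousMap.id_apply]
    exact min_eq_left (le_max_of_le_right (by linarith [(T.coord_nonneg_le_one hp w).2]))
  · rintro ⟨_, p, hp, rfl⟩
    refine Subtype.ext (funext fun w => ?_)
    have h0 := (T.coord_nonneg_le_one hp w).1
    simp only [truncate, Icc.coe_one, sub_self, mul_zero, zero_sub,
      ContinuousMap.const_apply, c, coord_root, Pi.zero_apply]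
    by_cases hw : w = T.root
    · subst hw
      have h1 : T.coord p T.root = 0 := by
        cases p with
        | vertex v => simp [coord_vertex, T.root_notMem_anc]
        | inner e t => simp [coord_inner, T.root_notMem_anc]
      rw [h1]
      exact min_eq_left (le_max_left _ _)
    · have h1 : (1 : ℝ) ≤ (T.anc w).card := by
        exact_mod_cast Finset.card_pos.2 ⟨w, T.self_mem_anc hw⟩
      rw [max_eq_left (by linarith), min_eq_right h0]

/-- A tree is contractible. -/
theorem contractibleSpace_carrier [Fintype V] [Finite E] : ContractibleSpace ↥T.carrier := by
  have : CompactSpace ↥T.carrier := isCompact_iff_compactSpace.1 T.isClosed_carrier.isCompact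
  have := T.contractibleSpace_image_coord
  have hcont : Continuous (Equiv.Set.imageOfInjOn T.coord T.carrier T.injOn_coord) :=
    (T.continuous_coord.comp continuous_subtype_val).subtype_mk _
  exact hcont.homeoOfEquivCompactToT2.contractibleSpace

end RootedTree

/-! ### Semibreak divisors from edges -/

theorem isOpenEdgeSegment_openEdge (G : MultiGraph V E) (e : E) :
    G.IsOpenEdgeSegment (G.openEdge e) := by
  have hconn : IsConnected (G.openEdge e) := by
    rw [← image_edgeMap_Ioo]
    exact (isConnected_Ioo one_pos).image _ (G.continuous_edgeMap e).continuousOn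
  have hsub : G.openEdge e ⊆ G.branchPointsᶜ := by
    rintro _ ⟨t, rfl⟩ h
    exact h rfl
  obtain ⟨x, hx⟩ := hconn.nonempty
  exact ⟨G.isOpen_openEdge e, hconn, _, ⟨x, hsub hx, rfl⟩,
    hconn.isPreconnected.subset_connectedComponentIn hx hsub⟩

theorem vertex_mem_closure_openEdge (G : MultiGraph V E) {e : E} {v : V}
    (hv : v = G.src e ∨ v = G.tgt e) : .vertex v ∈ closure (G.openEdge e) := by
  have h : G.edgeMap e '' closure (Ioo 0 1) ⊆ closure (G.openEdge e) := by
    rw [← image_edgeMap_Ioo]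
    exact image_closure_subset_closure_image (G.continuous_edgeMap e)
  rw [closure_Ioo zero_ne_one] at h
  rcases hv with rfl | rfl
  · exact h ⟨0, by simp, G.edgeMap_zero e⟩
  · exact h ⟨1, by simp, G.edgeMap_one e⟩

/-- Chips on distinct edges, moved to an end of their edge, form a semibreak divisor if deleting
these edges leaves the graph connected. -/
theorem isSemibreak_sum_single [Fintype V] [Nonempty V] [Fintype E] {G : MultiGraph V E}
    {F : Finset E} {head : E → V} (hhead : ∀ e ∈ F, head e = G.src e ∨ head e = G.tgt e)
    (hF : G.Linked {e | e ∉ F} univ) :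
    IsSemibreak (∑ e ∈ F, Finsupp.single (.vertex (head e)) 1 : G.Div) := by
  classical
  obtain ⟨T, hT⟩ := hF.exists_rootedTree
  let C : Finset E := (range T.edge)ᶜ.toFinset
  have hC : ∀ e, e ∈ C ↔ e ∉ range T.edge := fun e => by simp [C]
  have hFC : F ⊆ C := fun e he => (hC e).2 (by rintro ⟨v, rfl⟩; exact hT v he)
  have hcard : C.card = G.genus := by
    have h1 := T.ncard_range_edge
    have h2 := ncard_add_ncard_compl (range T.edge)
    rw [Nat.card_eq_fintype_card, ← ncard_coe_finset C] at *
    have h3 : (C : Set E) = (range T.edge)ᶜ := by simp [C]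
    rw [h3, genus]
    omega
  let ε : Fin G.genus ≃ C := (finCongr hcard.symm).trans C.equivFin.symm
  let head' : E → V := fun e => if e ∈ F then head e else G.src e
  have hnn : ∀ S : Finset E, (0 : G.Div) ≤ ∑ e ∈ S, Finsupp.single (.vertex (head' e)) 1 :=
    fun S => Finset.sum_nonneg fun e _ => Finsupp.single_nonneg.2 zero_le_one
  have hsumF : (∑ e ∈ F, Finsupp.single (.vertex (head e)) 1 : G.Div) =
      ∑ e ∈ F, Finsupp.single (.vertex (head' e)) 1 :=
    Finset.sum_congr rfl fun e he => by simp only [head', if_pos he]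
  rw [hsumF]
  refine ⟨hnn F, ∑ e ∈ C, Finsupp.single (.vertex (head' e)) 1,
    ⟨fun i => G.openEdge (ε i), fun i => .vertex (head' (ε i)),
      fun i => G.isOpenEdgeSegment_openEdge _, ?_, ?_, ?_, ?_⟩, ?_⟩
  · intro i j hij
    rw [Set.disjoint_left]
    rintro _ ⟨t, rfl⟩ ⟨t', h⟩
    have h' : (ε j : E) = ε i := (Point.inner.inj h).1
    exact hij (ε.injective (Subtype.ext h'.symm))
  · intro i
    refine G.vertex_mem_closure_openEdge ?_
    by_cases h : (ε i : E) ∈ F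
    · simpa only [head', if_pos h] using hhead _ h
    · simp only [head', if_neg h, true_or]
  · rw [Equiv.sum_comp ε fun e : C => (Finsupp.single (.vertex (head' e)) 1 : G.Div)]
    exact (Finset.sum_coe_sort C fun e => (Finsupp.single (.vertex (head' e)) 1 : G.Div)).symm
  · have h : (⋃ i, G.openEdge (ε i))ᶜ = T.carrier := by
      rw [T.carrier_eq]
      congr 1
      ext p
      simp only [mem_iUnion]
      constructor
      · rintro ⟨i, hi⟩
        exact ⟨ε i, (hC _).1 (ε i).2, hi⟩
      · rintro ⟨e, he, hp⟩
        exact ⟨ε.symm ⟨e, (hC e).2 he⟩, by simpa using hp⟩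
    rw [h]
    exact T.contractibleSpace_carrier
  · rw [← Finset.sum_sdiff hFC]
    exact le_add_of_nonneg_left (hnn _)

theorem Connected.exists_isSemibreak [Fintype V] [DecidableEq V] [Fintype E]
    {G : MultiGraph V E} (hG : G.Connected) {d : ℕ} (hd : d ≤ G.genus) {D : G.Div}
    (hD : IsIntegral D) (hdeg : deg D = d) (hne : (integralLinearSystem D).Nonempty) :
    ∃ D' ∈ linearSystem D, IsIntegral D' ∧ IsSemibreak D' := by
  classical
  have hlink := hG.linked
  have : Nonempty V := hG.nonempty
  obtain ⟨D₀, ⟨h0, hequiv⟩, hint⟩ := hne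
  obtain ⟨h, hh, hlap⟩ := (linEquiv_iff_of_isIntegral hint hD).1 hequiv
  have hsum : ∀ B : G.Div, IsIntegral B → deg B = ∑ v, B (.vertex v) := by
    intro B hB
    have hsub : B.support ⊆ Finset.univ.image Point.vertex := by
      intro p hp
      obtain ⟨v, rfl⟩ := hB p hp
      exact Finset.mem_image_of_mem _ (Finset.mem_univ v)
    rw [deg, Finsupp.sum_of_support_subset _ hsub _ (by simp),
      Finset.sum_image fun u _ v _ huv => by cases huv; rfl]
  have hdeg₀ : ∑ v, D₀ (.vertex v) = d := by
    have h1 := G.sum_lap h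
    rw [← hdeg, hsum D hD, ← sub_eq_zero, ← Finset.sum_sub_distrib]
    exact_mod_cast (Finset.sum_congr rfl fun v _ => hlap v).trans h1
  obtain ⟨F, head, ψ, -, hhead, hF, hchips⟩ :=
    hlink.exists_chips d hd (fun v => D₀ (.vertex v)) (fun v => h0 _) hdeg₀
  let D' : G.Div := ∑ e ∈ F, Finsupp.single (.vertex (head e)) 1
  have hsb : IsSemibreak D' := isSemibreak_sum_single hhead hF
  have hD' : ∀ p, D' p = ∑ e ∈ F, if Point.vertex (head e) = p then 1 else 0 := by
    intro p
    simp only [D', Finsupp.finsetSum_apply, Finsupp.single_apply]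
  have hint' : IsIntegral D' := by
    intro p hp
    rw [Finsupp.mem_support_iff, hD'] at hp
    obtain ⟨e, -, he⟩ := Finset.exists_ne_zero_of_sum_ne_zero hp
    exact ⟨head e, by by_contra hne; exact he (if_neg fun h => hne h.symm)⟩
  refine ⟨D', ⟨hsb.1, (linEquiv_iff_of_isIntegral hint' hD).2
    ⟨h + fun v => (ψ v : ℝ), fun e => ?_, fun v => ?_⟩⟩, hint', hsb⟩
  · obtain ⟨k, hk⟩ := hh e
    refine ⟨k + (ψ (G.tgt e) - ψ (G.src e)), ?_⟩
    push_cast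
    rw [← hk]
    simp only [Pi.add_apply]
    ring
  · have h1 : D' (.vertex v) = chips F head v := by
      rw [hD', chips]
      refine Finset.sum_congr rfl fun e _ => ?_
      by_cases he : head e = v <;> simp [he]
    rw [lap_add, lap_intCast, ← hlap, h1, hchips]
    push_cast
    ring

end MultiGraph

theorem proposition5p7 {V E : Type*} [Fintype V] [DecidableEq V] [Fintype E]
    (G : MultiGraph V E) (hG : G.Connected) (d : ℕ) (hd : d ≤ G.genus)
    (D : G.Div) (hD : MultiGraph.IsIntegral D) (hdeg : MultiGraph.deg D = d)
    (hne : (MultiGraph.integralLinearSystem D).Nonempty) :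
    (∃ D' ∈ MultiGraph.linearSystem D,
      MultiGraph.IsIntegral D' ∧ MultiGraph.IsSemibreak D') ∧
    ∀ D' ∈ MultiGraph.linearSystem D,
      MultiGraph.IsSemibreak D' → MultiGraph.IsIntegral D' :=
  ⟨hG.exists_isSemibreak hd hD hdeg hne, fun _ hD' hsb =>
    hD'.2.isIntegral hD (hsb.inner_chips hG.linked).1 (hsb.inner_chips hG.linked).2⟩
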